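/- Let $X$ be a compact metric space, $T:X\to X$ a homeomorphism and $\mu$ an ergodic $T$-invariant Borel probability measure. For a continuous $A:X\to GL(2,\mathbb R)$ put $A^n(x)=A(T^{n-1}x)\cdots A(x)$ and $A^{-n}(x)=A(T^{-n}x)^{-1}\cdots A(T^{-1}x)^{-1}$ for $n\ge 0$. The exponents $\lambda^+(A)$ and $\lambda^-(A)$ are the $\mu$-almost everywhere constant values of $\lim_{n\to\infty}\frac1n\log\|A^n(x)\|$ and $\lim_{n\to\infty}\frac1n\log\|A^{-n}(x)\|^{-1}$. A dominated splitting of $A$ is a continuous splitting $\mathbb R^2=E(x)\oplus F(x)$ into lines with $A(x)E(x)=E(Tx)$ and $A(x)F(x)=F(Tx)$ such that for every $x$ there is $l\ge1$ with $\|A^l(x)|_{E(x)}\|\cdot\|A^{-l}(T^lx)|_{F(T^lx)}\|<\frac12$. Let $R_\theta=\begin{pmatrix}\cos\theta&-\sin\theta\\ \sin\theta&\cos\theta\end{pmatrix}$ and $A_\theta(x)=A(x)R_\theta$. Cocycles $A,H$ are quasi-conjugated if there are $B(x),D(x)\in SO(2)$ and $s(x)\in\{1,-1\}$ (not necessarily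 continuous in $x$) with $H(x)=D(x)^{-1}A(x)B(x)$ and $B(Tx)=s(x)D(x)$ for all $x$. **Theorem.** Let $A:X\to GL(2,\mathbb R)$ be continuous, with $\det A(x)>0$ for all $x$, and with a dominated splitting. Then there is $\varepsilon>0$ such that $\lambda^-(A)$ exists, $\lambda^+(A_\theta)$ exists for all $\theta\in(-\varepsilon,\varepsilon)$, and: (i) There are continuous functions $a_\theta,c_\theta,u_\theta:X\to\mathbb R$, $\theta\in(-\varepsilon,\varepsilon)$, such that for all these $\theta$ one has $a_\theta(x)-c_\theta(x)\,u_\theta(Tx)>0$ for every $x\in X$, and $$\lambda^+(A_\theta)=\lambda^+(A)+\lambda^-(A)-\int_X\log\bigl(a_\theta(x)-c_\theta(x)\,u_\theta(Tx)\bigr)\,d\mu(x).$$ These functions can be taken as follows: there is a continuous lower triangular cocycle $H:X\to GL(2,\mathbb R)$, quasi-conjugated to $A$, such that $(a_\theta(x),c_\theta(x))$ is the first column of $H_\theta(x)=H(x)R_\theta$; $(\theta,x)\mapsto u_\theta(x)$ is continuous on $(-\varepsilon,\varepsilon)\times X$ with $u_0=0$; and for each $\theta\in(-\varepsilon,\varepsilon)$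 the cocycle $H_\theta$ has a dominated splitting $E_\theta\oplus F_\theta$ with $F_\theta(x)=\mathrm{span}\,(u_\theta(x),1)$. (ii) For each $x\in X$ the functions $\theta\mapsto a_\theta(x),\,c_\theta(x),\,u_\theta(x)$ are real analytic on $(-\varepsilon,\varepsilon)$. (iii) The function $\theta\mapsto\lambda^+(A_\theta)$ is real analytic on $(-\varepsilon,\varepsilon)$, and its second derivative at $\theta=0$ is negative. -/

import Mathlib

open Filter Topology MeasureTheory
open scoped Matrix

namespace RotatedCocycle

/-- The Euclidean plane. -/
abbrev Plane : Type := EuclideanSpace ℝ (Fin 2)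

/-- The matrix `M`, acting on the Euclidean plane. -/
noncomputable def act (M : GL (Fin 2) ℝ) : Plane →L[ℝ] Plane :=
  Matrix.toEuclideanCLM (n := Fin 2) (𝕜 := ℝ) (M : Matrix (Fin 2) (Fin 2) ℝ)

/-- The operator norm `‖M|V‖` of the restriction of `M` to the subspace `V` (Euclidean norms). -/
noncomputable def restrictNorm (M : GL (Fin 2) ℝ) (V : Submodule ℝ Plane) : ℝ :=
  ‖(act M).comp V.subtypeL‖

/-- The matrix `R_θ` of the rotation of angle `θ`. -/
noncomputable def rotation (θ : ℝ) : GL (Fin 2) ℝ :=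
  Matrix.GeneralLinearGroup.mkOfDetNeZero
    !![Real.cos θ, -Real.sin θ; Real.sin θ, Real.cos θ]
    (by
      rw [Matrix.det_fin_two_of]
      nlinarith [Real.sin_sq_add_cos_sq θ])

section

variable {X : Type*}

/-- The cocycle `A_θ(x) = A(x) R_θ`. -/
noncomputable def rotated (A : X → GL (Fin 2) ℝ) (θ : ℝ) : X → GL (Fin 2) ℝ :=
  fun x => A x * rotation θ

variable [TopologicalSpace X]

/-- Forward iterates `Aⁿ(x) = A(Tⁿ⁻¹x) ⋯ A(Tx) A(x)`. -/
noncomputable def fwd (T : X ≃ₜ X) (A : X → GL (Fin 2) ℝ) : ℕ → X → GL (Fin 2) ℝ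
  | 0, _ => 1
  | n + 1, x => A (T^[n] x) * fwd T A n x

/-- Backward iterates `A⁻ⁿ(x) = A(T⁻ⁿx)⁻¹ ⋯ A(T⁻¹x)⁻¹`. -/
noncomputable def bwd (T : X ≃ₜ X) (A : X → GL (Fin 2) ℝ) : ℕ → X → GL (Fin 2) ℝ
  | 0, _ => 1
  | n + 1, x => (A (T.symm^[n + 1] x))⁻¹ * bwd T A n x

/-- `L` is the upper Lyapunov exponent of `A` with respect to `μ`:
`(1/n) log ‖Aⁿ(x)‖ → L` for `μ`-almost every `x`. -/
def IsUpperExponent [MeasurableSpace X] (T : X ≃ₜ X) (μ : Measure X) (A : X → GL (Fin 2) ℝ)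
    (L : ℝ) : Prop :=
  ∀ᵐ x ∂μ, Tendsto (fun n : ℕ => (1 / (n : ℝ)) * Real.log ‖act (fwd T A n x)‖) atTop (𝓝 L)

/-- `L` is the lower Lyapunov exponent of `A` with respect to `μ`:
`(1/n) log ‖A⁻ⁿ(x)‖⁻¹ → L` for `μ`-almost every `x`. -/
def IsLowerExponent [MeasurableSpace X] (T : X ≃ₜ X) (μ : Measure X) (A : X → GL (Fin 2) ℝ)
    (L : ℝ) : Prop :=
  ∀ᵐ x ∂μ, Tendsto (fun n : ℕ => (1 / (n : ℝ)) * Real.log (‖act (bwd T A n x)‖⁻¹)) atTop (𝓝 L)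

open Classical in
/-- The number `λ⁺(A)`; it is `0` by convention if there is no exponent. -/
noncomputable def upperExponent [MeasurableSpace X] (T : X ≃ₜ X) (μ : Measure X)
    (A : X → GL (Fin 2) ℝ) : ℝ :=
  if h : ∃ L, IsUpperExponent T μ A L then h.choose else 0

open Classical in
/-- The number `λ⁻(A)`; it is `0` by convention if there is no exponent. -/
noncomputable def lowerExponent [MeasurableSpace X] (T : X ≃ₜ X) (μ : Measure X)
    (A : X → GL (Fin 2) ℝ) : ℝ :=
  if h : ∃ L, IsLowerExponent T μ A L then h.choose else 0

/-- A field of lines `x ↦ E x` is continuous if locally it is spanned by a continuous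
nowhere vanishing vector field. -/
def IsContinuousLineField (E : X → Submodule ℝ Plane) : Prop :=
  ∀ x₀ : X, ∃ U ∈ 𝓝 x₀, ∃ v : X → Plane,
    ContinuousOn v U ∧ ∀ x ∈ U, v x ≠ 0 ∧ E x = Submodule.span ℝ {v x}

/-- `ℝ² = E(x) ⊕ F(x)` is a dominated splitting of the cocycle `A` over `T`. -/
structure IsDominatedSplitting (T : X ≃ₜ X) (A : X → GL (Fin 2) ℝ)
    (E F : X → Submodule ℝ Plane) : Prop where
  continuous_E : IsContinuousLineField E
  continuous_F : IsContinuousLineField F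
  isCompl : ∀ x, IsCompl (E x) (F x)
  finrank_E : ∀ x, Module.finrank ℝ (E x) = 1
  finrank_F : ∀ x, Module.finrank ℝ (F x) = 1
  map_E : ∀ x, (E x).map (act (A x)).toLinearMap = E (T x)
  map_F : ∀ x, (F x).map (act (A x)).toLinearMap = F (T x)
  dominated : ∀ x, ∃ l : ℕ, 1 ≤ l ∧
    restrictNorm (fwd T A l x) (E x) *
      restrictNorm (bwd T A l (T^[l] x)) (F (T^[l] x)) < 1 / 2

/-- The cocycle `A` over `T` has dominated splitting. -/
def HasDominatedSplitting (T : X ≃ₜ X) (A : X → GL (Fin 2) ℝ) : Prop :=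
  ∃ E F : X → Submodule ℝ Plane, IsDominatedSplitting T A E F

/-- The cocycles `A` and `H` over `T` are quasi-conjugated: `H(x) = D(x)⁻¹ A(x) B(x)` with
`B(x), D(x) ∈ SO(2)` and `B(Tx) = s(x) D(x)`, `s(x) ∈ {1, -1}`; no continuity of `B`, `D`
in `x` is required. -/
def QuasiConjugated (T : X ≃ₜ X) (A H : X → GL (Fin 2) ℝ) : Prop :=
  ∃ (B D : X → Matrix (Fin 2) (Fin 2) ℝ) (s : X → ℝ),
    (∀ x, B x ∈ Matrix.specialOrthogonalGroup (Fin 2) ℝ) ∧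
    (∀ x, D x ∈ Matrix.specialOrthogonalGroup (Fin 2) ℝ) ∧
    (∀ x, s x = 1 ∨ s x = -1) ∧
    (∀ x, (H x : Matrix (Fin 2) (Fin 2) ℝ) = (D x)⁻¹ * (A x : Matrix (Fin 2) (Fin 2) ℝ) * B x) ∧
    ∀ x, B (T x) = s x • D x

end

end RotatedCocycle

/-!
For small `θ` the exponent `λ⁺(A_θ)` is the space average of a function that depends analytically
on `θ`, as an element of the Banach algebra `C(X, ℝ)`; analyticity and the second derivative are
then computed for that function.

**Reduction to a triangular cocycle.** Rotating orthonormal frames so that the second basis vector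
spans the dominating line `F` turns `A` into a continuous cocycle `H` with rows `(p, 0)` and
`(r, d)`, where `p, d > 0` (`exists_lowerTriangular`). The matrix `H(x)` depends only on the line
`F(x)`, not on the choice of a unit vector in it, which is why it is continuous. Domination and
compactness give a positive continuous weight `φ` and `ρ < 1` with `p · φ ∘ T ≤ ρ φ d`
(`exists_adapted_weight`). Quasi-conjugated cocycles have iterates of equal norm, and
quasi-conjugacy survives rotation, so it suffices to study `H_θ`.

**Invariant directions.** The spans of `(u, 1)` and `(1, e)` are invariant under `H_θ` when `u` and
`e` solve two equations in `C(X, ℝ)` that are analytic in `θ`. At `θ = 0` the linearized operators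
are `h ↦ d · h ∘ T - p h` and `h ↦ p · h ∘ T - d h`. In the weight `φ` both are invertible by a
Neumann series (`isUnit_backward_transfer`, `isUnit_forward_transfer`), so the analytic implicit
function theorem (`exists_analyticAt_implicit`) gives analytic curves `u_θ` and `e_θ`. Applied to
the exponential of `C(X, ℝ)` it also gives an analytic `l_θ` with `exp l_θ` equal to the factor by
which `H_θ` expands `(u, 1)`. The inequality in the weight `φ` is open, hence persists
(`exists_families`); it gives the dominated splitting of `H_θ` and shows that
`log ‖H_θⁿ(x)‖` and the Birkhoff sum of `l_θ` differ by a bounded amount.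

**Exponents.** By the pointwise ergodic theorem (`ae_tendsto_birkhoffSum`), `λ⁺(A_θ) = ∫ l_θ`. With
`‖M⁻¹‖ = ‖M‖ / |det M|` in dimension two, `λ⁻(A) = ∫ log p`. The number
`a_θ - c_θ · u_θ ∘ T` is the factor by which `H_θ` acts modulo `(u, 1)`, so its product with
`exp l_θ` is `det H_θ = p d`; taking logarithms gives the formula for the exponent.

**The second derivative.** Let `v` be the derivative of `u_θ` at `0`. Then `d · v ∘ T = p (v - 1)`,
and a maximum principle gives `v ≤ 0` (`nonpos_of_transfer`). The second derivative of `l_θ` at `0`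
equals `(2 v - 1) (1 + e₀²)` up to a coboundary (`second_jet_eq_coboundary`), so its integral is at
most `-1`.
-/

namespace RotatedCocycle


/-! ### The pointwise ergodic theorem for bounded functions -/

section Birkhoff

variable {α : Type*}

/-- `minBirkhoff T f n x` is the minimum of the Birkhoff sums `S₀ f x = 0, S₁ f x, …, Sₙ f x`, in
the recursive form that compares it with its value at `T x`. -/
noncomputable def minBirkhoff (T : α → α) (f : α → ℝ) : ℕ → α → ℝ
  | 0, _ => 0
  | n + 1, x => min 0 (f x + minBirkhoff T f n (T x))

lemma minBirkhoff_nonpos (T : α → α) (f : α → ℝ) (n : ℕ) (x : α) : minBirkhoff T f n x ≤ 0 := by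
  cases n with
  | zero => exact le_rfl
  | succ n => exact min_le_left _ _

lemma minBirkhoff_succ_le (T : α → α) (f : α → ℝ) (n : ℕ) (x : α) :
    minBirkhoff T f (n + 1) x ≤ minBirkhoff T f n x := by
  induction n generalizing x with
  | zero => exact min_le_left _ _
  | succ n ih => exact min_le_min le_rfl (by linarith [ih (T x)])

lemma minBirkhoff_antitone (T : α → α) (f : α → ℝ) (x : α) :
    Antitone fun n => minBirkhoff T f n x :=
  antitone_nat_of_succ_le fun n => minBirkhoff_succ_le T f n x

lemma minBirkhoff_le_birkhoffSum (T : α → α) (f : α → ℝ) (n : ℕ) (x : α) :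
    minBirkhoff T f n x ≤ birkhoffSum T f n x := by
  induction n generalizing x with
  | zero => simp [minBirkhoff]
  | succ n ih =>
    rw [birkhoffSum_succ']
    exact (min_le_right _ _).trans (by linarith [ih (T x)])

lemma abs_minBirkhoff_le {T : α → α} {f : α → ℝ} {C : ℝ} (hC : ∀ x, |f x| ≤ C) (n : ℕ) (x : α) :
    |minBirkhoff T f n x| ≤ n * C := by
  have hC0 : 0 ≤ C := (abs_nonneg _).trans (hC x)
  induction n generalizing x with
  | zero => simp [minBirkhoff]
  | succ n ih =>
    have h1 := abs_le.1 (ih (T x))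
    have h2 := abs_le.1 (hC x)
    rw [abs_of_nonpos (minBirkhoff_nonpos ..)]
    have : -((n + 1 : ℕ) * C) ≤ minBirkhoff T f (n + 1) x :=
      le_min (by have : (0 : ℝ) ≤ (n + 1 : ℕ) * C := by positivity
                 linarith) (by push_cast; linarith)
    linarith

variable [MeasurableSpace α]

lemma measurable_minBirkhoff {T : α → α} {f : α → ℝ} (hT : Measurable T) (hf : Measurable f)
    (n : ℕ) : Measurable (minBirkhoff T f n) := by
  induction n with
  | zero => exact measurable_const
  | succ n ih => exact measurable_const.min (hf.add (ih.comp hT))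

variable {μ : Measure α}

/-- The set on which the Birkhoff sums are unbounded below is invariant. If it had full measure,
then `minBirkhoff T f (n + 1) - minBirkhoff T f n ∘ T` would converge to `f` and have nonpositive
integrals. -/
theorem ae_bddBelow_birkhoffSum [IsProbabilityMeasure μ] {T : α → α} (hT : Ergodic T μ)
    {f : α → ℝ} (hf : Measurable f) {C : ℝ} (hC : ∀ x, |f x| ≤ C) (hpos : 0 < ∫ x, f x ∂μ) :
    ∀ᵐ x ∂μ, ∃ K : ℝ, ∀ n, K ≤ birkhoffSum T f n x := by
  set M := minBirkhoff T f with hM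
  have hmeas := measurable_minBirkhoff hT.measurable hf
  let D : Set α := {x | ∀ k : ℕ, ∃ n, M n x < -(k : ℝ)}
  have hDm : MeasurableSet D := by
    have : D = ⋂ k : ℕ, ⋃ n, {x | M n x < -(k : ℝ)} := by ext; simp [D]
    rw [this]
    exact MeasurableSet.iInter fun k => MeasurableSet.iUnion fun n =>
      measurableSet_lt (hmeas n) measurable_const
  have hDinv : T ⁻¹' D = D := by
    ext x
    constructor
    · intro h k
      obtain ⟨j, hj⟩ := exists_nat_gt (k + C)
      obtain ⟨n, hn⟩ := h j
      refine ⟨n + 1, (min_le_right _ _).trans_lt ?_⟩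
      have := (abs_le.1 (hC x)).2
      change M n (T x) < _ at hn
      change f x + M n (T x) < _
      linarith
    · intro h k
      obtain ⟨j, hj⟩ := exists_nat_gt (k + C)
      obtain ⟨n, hn⟩ := h j
      have hn' : M (n + 1) x < -(j : ℝ) := (minBirkhoff_succ_le T f n x).trans_lt hn
      refine ⟨n, ?_⟩
      have h1 := (abs_le.1 (hC x)).1
      have hC0 : 0 ≤ C := (abs_nonneg _).trans (hC x)
      have hk0 : (0 : ℝ) ≤ k := k.cast_nonneg
      change min 0 (f x + M n (T x)) < _ at hn'
      change M n (T x) < _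
      rcases min_lt_iff.1 hn' with h2 | h2 <;> linarith
  have hnull : ∀ᵐ x ∂μ, x ∉ D := by
    rcases hT.toPreErgodic.ae_mem_or_ae_notMem hDm hDinv with h | h
    · exfalso
      have hint : ∀ n, Integrable (M n) μ := fun n =>
        Integrable.of_bound (hmeas n).aestronglyMeasurable (n * C)
          (ae_of_all _ fun x => abs_minBirkhoff_le hC n x)
      have hle : ∀ n, ∫ x, min (-M n (T x)) (f x) ∂μ ≤ 0 := by
        intro n
        have e : ∀ x, min (-M n (T x)) (f x) = M (n + 1) x - M n (T x) := by
          intro x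
          change _ = min 0 (f x + M n (T x)) - M n (T x)
          rw [← min_sub_sub_right]; simp
        simp_rw [e]
        have hcomp : ∫ x, M n (T x) ∂μ = ∫ x, M n x ∂μ := by
          rw [← integral_map (f := M n) hT.measurable.aemeasurable
            (hmeas n).aestronglyMeasurable, hT.toMeasurePreserving.map_eq]
        have hi : Integrable (fun x => M n (T x)) μ :=
          hT.toMeasurePreserving.integrable_comp_of_integrable (hint n)
        rw [integral_sub (hint _) hi, hcomp]
        linarith [integral_mono (hint (n + 1)) (hint n) fun x => minBirkhoff_succ_le T f n x]
      have hlim : Tendsto (fun n => ∫ x, min (-M n (T x)) (f x) ∂μ) atTop (𝓝 (∫ x, f x ∂μ)) := by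
        refine tendsto_integral_of_dominated_convergence (fun _ => C) (fun n => ?_)
          (integrable_const C) (fun n => ae_of_all _ fun x => ?_) ?_
        · exact (((hmeas n).comp hT.measurable).neg.min hf).aestronglyMeasurable
        · have h0 := minBirkhoff_nonpos T f n (T x)
          have h1 := abs_le.1 (hC x)
          rw [Real.norm_eq_abs, abs_le]
          exact ⟨le_min (by linarith) h1.1, (min_le_right _ _).trans h1.2⟩
        · have h' : ∀ᵐ x ∂μ, x ∈ T ⁻¹' D := by rw [hDinv]; exact h
          filter_upwards [h'] with x hx
          refine tendsto_const_nhds.congr' ?_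
          obtain ⟨k, hk⟩ := exists_nat_gt (f x)
          obtain ⟨n, hn⟩ := hx k
          filter_upwards [eventually_ge_atTop n] with m hm
          have := minBirkhoff_antitone T f (T x) hm
          exact (min_eq_right (by change M n (T x) < _ at hn; change M m (T x) ≤ M n (T x) at this
                                  linarith)).symm
      linarith [le_of_tendsto' hlim hle]
    · exact h
  filter_upwards [hnull] with x hx
  simp only [D, Set.mem_ofPred_eq, not_forall, not_exists, not_lt] at hx
  obtain ⟨k, hk⟩ := hx
  exact ⟨-(k : ℝ), fun n => (hk n).trans (minBirkhoff_le_birkhoffSum T f n x)⟩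

/-- Apply the preceding theorem to `f - ∫ f + δ / 2`: Birkhoff sums that are bounded below have
nonnegative lower averages. -/
lemma ae_eventually_le_birkhoffAverage [IsProbabilityMeasure μ] {T : α → α} (hT : Ergodic T μ)
    {f : α → ℝ} (hf : Measurable f) {C : ℝ} (hC : ∀ x, |f x| ≤ C) {δ : ℝ} (hδ : 0 < δ) :
    ∀ᵐ x ∂μ, ∀ᶠ n : ℕ in atTop,
      (∫ y, f y ∂μ) - δ < (1 / (n : ℝ)) * birkhoffSum T f n x := by
  set I := ∫ y, f y ∂μ
  have hfi : Integrable f μ := Integrable.of_bound hf.aestronglyMeasurable C (ae_of_all _ hC)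
  have hb := ae_bddBelow_birkhoffSum (μ := μ) hT (f := fun x => f x + (δ / 2 - I))
    (hf.add_const _) (C := C + |δ / 2 - I|)
    (fun x => (abs_add_le _ _).trans (by linarith [hC x])) (by
      rw [integral_add hfi (integrable_const _)]
      simp only [integral_const, probReal_univ, smul_eq_mul, one_mul]
      change 0 < I + (δ / 2 - I)
      linarith)
  filter_upwards [hb] with x ⟨K, hK⟩
  obtain ⟨N, hN⟩ := exists_nat_gt (-K / (δ / 2))
  filter_upwards [eventually_ge_atTop N, eventually_gt_atTop 0] with n hn hn0
  have hn0' : (0 : ℝ) < n := by exact_mod_cast hn0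
  have hnN : (N : ℝ) ≤ n := by exact_mod_cast hn
  have h1 := hK n
  have e : birkhoffSum T (fun x => f x + (δ / 2 - I)) n x
      = birkhoffSum T f n x + n * (δ / 2 - I) := by
    simp [birkhoffSum, Finset.sum_add_distrib]
    ring
  rw [e] at h1
  rw [div_lt_iff₀ (by positivity)] at hN
  rw [one_div, lt_inv_mul_iff₀ hn0']
  nlinarith

/-- Birkhoff's theorem for an ergodic map and a bounded measurable function. -/
theorem ae_tendsto_birkhoffSum [IsProbabilityMeasure μ] {T : α → α} (hT : Ergodic T μ)
    {f : α → ℝ} (hf : Measurable f) {C : ℝ} (hC : ∀ x, |f x| ≤ C) :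
    ∀ᵐ x ∂μ, Tendsto (fun n : ℕ => (1 / (n : ℝ)) * birkhoffSum T f n x) atTop
      (𝓝 (∫ y, f y ∂μ)) := by
  have h1 : ∀ᵐ x ∂μ, ∀ k : ℕ, ∀ᶠ n : ℕ in atTop,
      (∫ y, f y ∂μ) - 1 / (k + 1 : ℝ) < (1 / (n : ℝ)) * birkhoffSum T f n x :=
    ae_all_iff.2 fun k => ae_eventually_le_birkhoffAverage hT hf hC (by positivity)
  have h2 : ∀ᵐ x ∂μ, ∀ k : ℕ, ∀ᶠ n : ℕ in atTop,
      (∫ y, -f y ∂μ) - 1 / (k + 1 : ℝ) < (1 / (n : ℝ)) * birkhoffSum T (fun y => -f y) n x :=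
    ae_all_iff.2 fun k => ae_eventually_le_birkhoffAverage hT hf.neg
      (fun x => by rw [Pi.neg_apply, abs_neg]; exact hC x) (by positivity)
  filter_upwards [h1, h2] with x hx1 hx2
  rw [Metric.tendsto_atTop']
  intro δ hδ
  obtain ⟨k, hk⟩ := exists_nat_one_div_lt hδ
  obtain ⟨N, hN⟩ := eventually_atTop.1 ((hx1 k).and (hx2 k))
  refine ⟨N, fun n hn => ?_⟩
  obtain ⟨h3, h4⟩ := hN n hn.le
  rw [integral_neg] at h4
  have e : birkhoffSum T (fun y => -f y) n x = -birkhoffSum T f n x := by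
    simp [birkhoffSum]
  rw [e] at h4
  rw [Real.dist_eq, abs_lt]
  constructor <;> linarith

end Birkhoff


/-! ### Operator norms of plane matrices -/

lemma act_one : act 1 = 1 := by simp [act]

lemma act_mul (M N : GL (Fin 2) ℝ) : act (M * N) = act M * act N := by simp [act]

lemma act_mul_apply (M N : GL (Fin 2) ℝ) (v : Plane) : act (M * N) v = act M (act N v) := by
  rw [act_mul]; rfl

lemma act_inv_apply (M : GL (Fin 2) ℝ) (v : Plane) : act M⁻¹ (act M v) = v := by
  rw [← act_mul_apply, inv_mul_cancel, act_one]; rfl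

lemma act_apply_ne_zero (M : GL (Fin 2) ℝ) {v : Plane} (hv : v ≠ 0) : act M v ≠ 0 := fun h =>
  hv (by rw [← act_inv_apply M v, h, map_zero])

lemma act_apply_zero (M : GL (Fin 2) ℝ) (v : Plane) : act M v 0 = M 0 0 * v 0 + M 0 1 * v 1 := by
  simp [act, Matrix.mulVec, dotProduct, Fin.sum_univ_two]

lemma act_apply_one (M : GL (Fin 2) ℝ) (v : Plane) : act M v 1 = M 1 0 * v 0 + M 1 1 * v 1 := by
  simp [act, Matrix.mulVec, dotProduct, Fin.sum_univ_two]

lemma norm_sq_plane (v : Plane) : ‖v‖ ^ 2 = v 0 ^ 2 + v 1 ^ 2 := by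
  rw [EuclideanSpace.norm_sq_eq, Fin.sum_univ_two, Real.norm_eq_abs, Real.norm_eq_abs, sq_abs,
    sq_abs]

lemma toEuclideanCLM_mem_unitary {U : Matrix (Fin 2) (Fin 2) ℝ}
    (hU : U ∈ Matrix.specialOrthogonalGroup (Fin 2) ℝ) :
    Matrix.toEuclideanCLM (n := Fin 2) (𝕜 := ℝ) U ∈ unitary (Plane →L[ℝ] Plane) := by
  have h : U ∈ unitary (Matrix (Fin 2) (Fin 2) ℝ) := (Matrix.mem_specialOrthogonalGroup_iff.1 hU).1
  exact Unitary.map_mem _ h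

lemma quarterTurn_mem :
    (!![0, -1; 1, 0] : Matrix (Fin 2) (Fin 2) ℝ) ∈ Matrix.specialOrthogonalGroup (Fin 2) ℝ := by
  rw [Matrix.mem_specialOrthogonalGroup_iff, Matrix.mem_orthogonalGroup_iff]
  constructor
  · ext i j; fin_cases i <;> fin_cases j <;> simp [Matrix.mul_apply, Fin.sum_univ_two]
  · simp

/-- In dimension two the adjugate is conjugate to the transpose by a quarter turn, so it has the
same norm as the matrix. -/
lemma norm_act_inv (M : GL (Fin 2) ℝ) :
    ‖act M⁻¹‖ = |(M : Matrix (Fin 2) (Fin 2) ℝ).det|⁻¹ * ‖act M‖ := by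
  set J : Matrix (Fin 2) (Fin 2) ℝ := !![0, -1; 1, 0] with hJ
  have hadj : (M : Matrix (Fin 2) (Fin 2) ℝ).adjugate =
      J * star (M : Matrix (Fin 2) (Fin 2) ℝ) * star J := by
    rw [Matrix.adjugate_fin_two]
    ext i j
    fin_cases i <;> fin_cases j <;>
      simp [hJ, Matrix.mul_apply, Fin.sum_univ_two, Matrix.vecMul, dotProduct, Matrix.star_apply]
  have hu := toEuclideanCLM_mem_unitary quarterTurn_mem
  have hinv : ((M⁻¹ : GL (Fin 2) ℝ) : Matrix (Fin 2) (Fin 2) ℝ) =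
      (M : Matrix (Fin 2) (Fin 2) ℝ).det⁻¹ • (J * star (M : Matrix (Fin 2) (Fin 2) ℝ) * star J) := by
    rw [Matrix.coe_units_inv, Matrix.inv_def, hadj, Ring.inverse_eq_inv']
  rw [act, hinv, map_smul, norm_smul, map_mul, map_mul, map_star, map_star, norm_inv,
    Real.norm_eq_abs, CStarRing.norm_mul_mem_unitary _ (Unitary.star_mem hu),
    CStarRing.norm_mem_unitary_mul _ hu, ContinuousLinearMap.star_eq_adjoint,
    LinearIsometryEquiv.norm_map, act]

lemma restrictNorm_span {M : GL (Fin 2) ℝ} {v w : Plane} {κ : ℝ} (hv : v ≠ 0)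
    (h : act M v = κ • w) : restrictNorm M (Submodule.span ℝ {v}) = |κ| * (‖w‖ / ‖v‖) := by
  have hv' : 0 < ‖v‖ := norm_pos_iff.2 hv
  have key : ∀ t : ℝ, ‖act M (t • v)‖ = |κ| * (‖w‖ / ‖v‖) * ‖t • v‖ := by
    intro t
    rw [map_smul, h, norm_smul, norm_smul, norm_smul, Real.norm_eq_abs κ]
    field_simp
  apply le_antisymm
  · refine ContinuousLinearMap.opNorm_le_bound _ (by positivity) fun z => ?_
    obtain ⟨z, hz⟩ := z
    obtain ⟨t, rfl⟩ := Submodule.mem_span_singleton.1 hz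
    exact (key t).le
  · have h1 := ((act M).comp (Submodule.span ℝ {v}).subtypeL).le_opNorm
      ⟨v, Submodule.mem_span_singleton_self v⟩
    have h2 := key 1
    rw [one_smul] at h2
    change ‖act M v‖ ≤ restrictNorm M _ * ‖v‖ at h1
    rw [h2] at h1
    exact le_of_mul_le_mul_right h1 hv'

/-! ### Iterates of a cocycle along invariant vector fields -/

section Iterates

variable {X : Type*} [TopologicalSpace X] (T : X ≃ₜ X) (A : X → GL (Fin 2) ℝ)

lemma fwd_succ' (n : ℕ) (x : X) : fwd T A (n + 1) x = fwd T A n (T x) * A x := by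
  induction n with
  | zero => simp [fwd]
  | succ n ih =>
    rw [fwd, ih, ← mul_assoc]
    rfl

lemma symm_iterate_iterate (n : ℕ) (x : X) : T.symm^[n] (T^[n] x) = x :=
  (Function.LeftInverse.iterate T.symm_apply_apply n) x

lemma iterate_symm_iterate (n : ℕ) (x : X) : T^[n] (T.symm^[n] x) = x :=
  (Function.LeftInverse.iterate T.apply_symm_apply n) x

lemma bwd_iterate (n : ℕ) (x : X) : bwd T A n (T^[n] x) = (fwd T A n x)⁻¹ := by
  induction n generalizing x with
  | zero => simp [fwd, bwd]
  | succ n ih =>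
    rw [bwd, symm_iterate_iterate, Function.iterate_succ_apply, ih, fwd_succ', mul_inv_rev]

lemma det_fwd (n : ℕ) (x : X) : (fwd T A n x : Matrix (Fin 2) (Fin 2) ℝ).det =
    ∏ i ∈ Finset.range n, (A (T^[i] x) : Matrix (Fin 2) (Fin 2) ℝ).det := by
  induction n with
  | zero => simp [fwd]
  | succ n ih => rw [fwd, Units.val_mul, Matrix.det_mul, ih, Finset.prod_range_succ, mul_comm]

variable {T A}

lemma act_fwd_of_invariant {w : X → Plane} {κ : X → ℝ}
    (h : ∀ x, act (A x) (w x) = κ x • w (T x)) (n : ℕ) (x : X) :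
    act (fwd T A n x) (w x) = (∏ i ∈ Finset.range n, κ (T^[i] x)) • w (T^[n] x) := by
  induction n with
  | zero => simp [fwd, act_one]
  | succ n ih =>
    rw [fwd, act_mul_apply, ih, map_smul, h, smul_smul, Finset.prod_range_succ,
      Function.iterate_succ_apply']

/-- The quantity that defines domination, in terms of multipliers along invariant vector fields. -/
lemma restrictNorm_fwd_mul_restrictNorm_bwd {w₁ w₂ : X → Plane} {α m : X → ℝ}
    (h₁ : ∀ x, act (A x) (w₁ x) = α x • w₁ (T x)) (h₂ : ∀ x, act (A x) (w₂ x) = m x • w₂ (T x))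
    (hw₁ : ∀ x, w₁ x ≠ 0) (hw₂ : ∀ x, w₂ x ≠ 0) (n : ℕ) (x : X) :
    restrictNorm (fwd T A n x) (Submodule.span ℝ {w₁ x}) *
      restrictNorm (bwd T A n (T^[n] x)) (Submodule.span ℝ {w₂ (T^[n] x)}) =
    (∏ i ∈ Finset.range n, |α (T^[i] x)| / |m (T^[i] x)|) *
      (‖w₁ (T^[n] x)‖ / ‖w₁ x‖ * (‖w₂ x‖ / ‖w₂ (T^[n] x)‖)) := by
  have hm : ∀ x, m x ≠ 0 := fun x hx => act_apply_ne_zero (A x) (hw₂ x) (by rw [h₂, hx, zero_smul])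
  have hprod : ∏ i ∈ Finset.range n, m (T^[i] x) ≠ 0 := Finset.prod_ne_zero_iff.2 fun i _ => hm _
  have hb : act (bwd T A n (T^[n] x)) (w₂ (T^[n] x)) =
      (∏ i ∈ Finset.range n, m (T^[i] x))⁻¹ • w₂ x := by
    rw [bwd_iterate, eq_inv_smul_iff₀ hprod, ← map_smul, ← act_fwd_of_invariant h₂, act_inv_apply]
  rw [restrictNorm_span (hw₁ x) (act_fwd_of_invariant h₁ n x), restrictNorm_span (hw₂ _) hb,
    Finset.prod_div_distrib, abs_inv, Finset.abs_prod, Finset.abs_prod]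
  ring

/-- If the product of the ratios of the multipliers along two transverse invariant directions is
bounded, then the norm of the iterates is the product of the larger multipliers, up to a bounded
factor. -/
lemma exists_abs_log_norm_fwd_sub_le {w₁ w₂ : X → Plane} {α m : X → ℝ} {K C : ℝ}
    (h₁ : ∀ x, act (A x) (w₁ x) = α x • w₁ (T x)) (h₂ : ∀ x, act (A x) (w₂ x) = m x • w₂ (T x))
    (hw₁ : ∀ x, ‖w₁ x‖ ≤ K) (hw₂ : ∀ x, ‖w₂ x‖ ≤ K) (hw₂' : ∀ x, 1 ≤ ‖w₂ x‖)
    (hspan : ∀ x z, ∃ s t : ℝ, z = s • w₁ x + t • w₂ x ∧ |s| ≤ K * ‖z‖ ∧ |t| ≤ K * ‖z‖)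
    (hα : ∀ x, 0 < α x) (hm : ∀ x, 0 < m x)
    (hC : ∀ n x, ∏ i ∈ Finset.range n, α (T^[i] x) ≤ C * ∏ i ∈ Finset.range n, m (T^[i] x)) :
    ∃ B : ℝ, ∀ n x, |Real.log ‖act (fwd T A n x)‖ -
      birkhoffSum T (fun y => Real.log (m y)) n x| ≤ B := by
  rcases isEmpty_or_nonempty X with hX | ⟨⟨x₀⟩⟩
  · exact ⟨0, fun n x => (hX.false x).elim⟩
  have hK : 1 ≤ K := (hw₂' x₀).trans (hw₂ x₀)
  have hK0 : 0 < K := by linarith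
  have hC0 : 1 ≤ C := by simpa using hC 0 x₀
  set L := K * K * C + K * K with hL
  have hL0 : 0 < L := by positivity
  refine ⟨Real.log K + Real.log L, fun n x => ?_⟩
  set Pm := ∏ i ∈ Finset.range n, m (T^[i] x) with hPm
  set Pα := ∏ i ∈ Finset.range n, α (T^[i] x) with hPα
  have hPm0 : 0 < Pm := Finset.prod_pos fun i _ => hm _
  have hPα0 : 0 < Pα := Finset.prod_pos fun i _ => hα _
  have hlog : birkhoffSum T (fun y => Real.log (m y)) n x = Real.log Pm := by
    rw [hPm, Real.log_prod fun i _ => (hm _).ne']; rfl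
  have hup : ‖act (fwd T A n x)‖ ≤ L * Pm := by
    refine ContinuousLinearMap.opNorm_le_bound _ (by positivity) fun z => ?_
    obtain ⟨s, t, hz, hs, ht⟩ := hspan x z
    have e : act (fwd T A n x) z = (s * Pα) • w₁ (T^[n] x) + (t * Pm) • w₂ (T^[n] x) := by
      conv_lhs => rw [hz]
      rw [map_add, map_smul, map_smul, act_fwd_of_invariant h₁, act_fwd_of_invariant h₂, smul_smul,
        smul_smul]
    rw [e]
    calc _ ≤ |s| * Pα * ‖w₁ (T^[n] x)‖ + |t| * Pm * ‖w₂ (T^[n] x)‖ := by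
            refine (norm_add_le _ _).trans_eq ?_
            rw [norm_smul, norm_smul, Real.norm_eq_abs, Real.norm_eq_abs, abs_mul, abs_mul,
              abs_of_pos hPα0, abs_of_pos hPm0]
      _ ≤ (K * ‖z‖) * (C * Pm) * K + (K * ‖z‖) * Pm * K := by
            have := hC n x
            gcongr
            · exact hw₁ _
            · exact hw₂ _
      _ = L * Pm * ‖z‖ := by rw [hL]; ring
  have hlow : Pm ≤ K * ‖act (fwd T A n x)‖ := by
    have h := (act (fwd T A n x)).le_opNorm (w₂ x)
    rw [act_fwd_of_invariant h₂, norm_smul, Real.norm_eq_abs, abs_of_pos hPm0] at h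
    have h3 := hw₂ x
    calc Pm ≤ Pm * ‖w₂ (T^[n] x)‖ := le_mul_of_one_le_right hPm0.le (hw₂' _)
      _ ≤ ‖act (fwd T A n x)‖ * ‖w₂ x‖ := h
      _ ≤ ‖act (fwd T A n x)‖ * K := by gcongr
      _ = _ := mul_comm _ _
  have hpos : 0 < ‖act (fwd T A n x)‖ := by
    by_contra hcon
    have : ‖act (fwd T A n x)‖ = 0 := le_antisymm (not_lt.1 hcon) (norm_nonneg _)
    rw [this, mul_zero] at hlow
    linarith
  have h1 := Real.log_le_log hpos hup
  have h2 := Real.log_le_log hPm0 hlow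
  rw [Real.log_mul hL0.ne' hPm0.ne'] at h1
  rw [Real.log_mul hK0.ne' hpos.ne'] at h2
  have hKl : 0 ≤ Real.log K := Real.log_nonneg hK
  have hLl : 0 ≤ Real.log L := Real.log_nonneg (by nlinarith [mul_pos hK0 hK0])
  rw [hlog, abs_le]
  constructor <;> linarith

end Iterates

/-! ### Exponents as space averages -/

section Exponents

variable {X : Type*} [TopologicalSpace X] [MeasurableSpace X] {T : X ≃ₜ X} {μ : Measure X}
  {A : X → GL (Fin 2) ℝ}

lemma upperExponent_eq [NeZero μ] {L : ℝ} (h : IsUpperExponent T μ A L) :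
    upperExponent T μ A = L := by
  have hex : ∃ L, IsUpperExponent T μ A L := ⟨L, h⟩
  rw [upperExponent, dif_pos hex]
  obtain ⟨x, hx⟩ := (hex.choose_spec.and h).exists
  exact tendsto_nhds_unique hx.1 hx.2

lemma lowerExponent_eq [NeZero μ] {L : ℝ} (h : IsLowerExponent T μ A L) :
    lowerExponent T μ A = L := by
  have hex : ∃ L, IsLowerExponent T μ A L := ⟨L, h⟩
  rw [lowerExponent, dif_pos hex]
  obtain ⟨x, hx⟩ := (hex.choose_spec.and h).exists
  exact tendsto_nhds_unique hx.1 hx.2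

lemma tendsto_of_abs_sub_le {s t : ℕ → ℝ} {L B : ℝ}
    (h : Tendsto (fun n : ℕ => (1 / (n : ℝ)) * s n) atTop (𝓝 L)) (hB : ∀ n, |t n - s n| ≤ B) :
    Tendsto (fun n : ℕ => (1 / (n : ℝ)) * t n) atTop (𝓝 L) := by
  have h0 : Tendsto (fun n : ℕ => (1 / (n : ℝ)) * (t n - s n)) atTop (𝓝 0) := by
    refine squeeze_zero_norm (a := fun n : ℕ => (1 / (n : ℝ)) * B) (fun n => ?_) ?_
    · rw [norm_mul, Real.norm_eq_abs, Real.norm_eq_abs, abs_of_nonneg (by positivity)]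
      exact mul_le_mul_of_nonneg_left (hB n) (by positivity)
    · simpa using tendsto_one_div_atTop_nhds_zero_nat.mul_const B
  have := h.add h0
  rw [add_zero] at this
  exact this.congr fun n => by ring

variable [BorelSpace X] [IsProbabilityMeasure μ]

/-- If the logarithm of the norm of the iterates is a Birkhoff sum of `g` up to a bounded error, then
the upper exponent is the space average of `g`. -/
lemma isUpperExponent_of_abs_sub_le (hμ : Ergodic T μ) {g : X → ℝ} (hg : Continuous g) {C B : ℝ}
    (hC : ∀ x, |g x| ≤ C)
    (hB : ∀ n x, |Real.log ‖act (fwd T A n x)‖ - birkhoffSum T g n x| ≤ B) :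
    IsUpperExponent T μ A (∫ x, g x ∂μ) := by
  filter_upwards [ae_tendsto_birkhoffSum hμ hg.measurable hC] with x hx
  exact tendsto_of_abs_sub_le hx fun n => hB n x

/-- The backward iterate from `x` is the inverse of the forward iterate from `T⁻ⁿ x`, and the norm of
the inverse of a plane matrix is its norm divided by its determinant. So if `g` gives the growth of
the norm and `log det A = g + h`, then `h` gives the lower exponent. -/
lemma isLowerExponent_of_abs_sub_le (hμ : Ergodic T μ) {g h : X → ℝ}
    (hh : Continuous h) {C B : ℝ} (hC : ∀ x, |h x| ≤ C)
    (hdet : ∀ x, 0 < (A x : Matrix (Fin 2) (Fin 2) ℝ).det)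
    (hgh : ∀ x, Real.log (A x : Matrix (Fin 2) (Fin 2) ℝ).det = g x + h x)
    (hB : ∀ n x, |Real.log ‖act (fwd T A n x)‖ - birkhoffSum T g n x| ≤ B) :
    IsLowerExponent T μ A (∫ x, h x ∂μ) := by
  have hsymm : Ergodic (T.symm : X → X) μ :=
    Ergodic.symm (e := T.toMeasurableEquiv) hμ
  have hint : ∫ x, h (T.symm x) ∂μ = ∫ x, h x ∂μ := by
    rw [← integral_map (f := h) hsymm.measurable.aemeasurable
      hh.measurable.aestronglyMeasurable, hsymm.toMeasurePreserving.map_eq]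
  have hae := ae_tendsto_birkhoffSum hsymm (f := fun x => h (T.symm x))
    (hh.comp T.symm.continuous).measurable (fun x => hC _)
  rw [hint] at hae
  filter_upwards [hae] with x hx
  refine tendsto_of_abs_sub_le hx (B := B) fun n => ?_
  set y := T.symm^[n] x with hy
  have hbwd : bwd T A n x = (fwd T A n y)⁻¹ := by
    rw [← bwd_iterate, hy, iterate_symm_iterate]
  have hdet0 : 0 < (fwd T A n y : Matrix (Fin 2) (Fin 2) ℝ).det := by
    rw [det_fwd]; exact Finset.prod_pos fun i _ => hdet _
  have hne : ‖act (fwd T A n y)‖ ≠ 0 := by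
    rw [norm_ne_zero_iff]
    intro h0
    have := act_apply_ne_zero (fwd T A n y) (v := EuclideanSpace.single 0 1) (by simp)
    rw [h0] at this
    exact this rfl
  have hsum : birkhoffSum T.symm (fun x => h (T.symm x)) n x = birkhoffSum T h n y := by
    rw [birkhoffSum, birkhoffSum, ← Finset.sum_range_reflect]
    refine Finset.sum_congr rfl fun i hi => ?_
    have hi' : i < n := Finset.mem_range.1 hi
    congr 1
    rw [← Function.iterate_succ_apply' (T.symm : X → X), hy]
    have : n = i + (n - 1 - i + 1) := by omega
    conv_rhs => rw [this, Function.iterate_add_apply]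
    rw [iterate_symm_iterate]
  have hlogdet : Real.log (fwd T A n y : Matrix (Fin 2) (Fin 2) ℝ).det =
      birkhoffSum T g n y + birkhoffSum T h n y := by
    rw [det_fwd, Real.log_prod fun i _ => (hdet _).ne', birkhoffSum, birkhoffSum,
      ← Finset.sum_add_distrib]
    exact Finset.sum_congr rfl fun i _ => hgh _
  rw [hbwd, norm_act_inv, abs_of_pos hdet0, Real.log_inv, Real.log_mul (inv_pos.2 hdet0).ne' hne,
    Real.log_inv, hlogdet, hsum]
  have := hB n y
  rw [abs_sub_comm] at this
  convert this using 2
  ring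

end Exponents


/-! ### Adapted weights -/

section Adapted

variable {X : Type*} [TopologicalSpace X] {T : X ≃ₜ X}

lemma continuous_prod_iterate {q : X → ℝ} (hq : Continuous q) (n : ℕ) :
    Continuous fun x => ∏ i ∈ Finset.range n, q (T^[i] x) :=
  continuous_finsetProd _ fun i _ => hq.comp (T.continuous.iterate i)

lemma prod_range_add_iterate (q : X → ℝ) (m n : ℕ) (x : X) :
    ∏ i ∈ Finset.range (m + n), q (T^[i] x) =
      (∏ i ∈ Finset.range m, q (T^[i] x)) * ∏ i ∈ Finset.range n, q (T^[i] (T^[m] x)) := by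
  rw [Finset.prod_range_add]
  congr 1
  refine Finset.prod_congr rfl fun i _ => ?_
  rw [← Function.iterate_add_apply, add_comm]

lemma prod_iterate_mul_le {q φ : X → ℝ} {ρ : ℝ} (hρ : 0 ≤ ρ) (hq0 : ∀ x, 0 ≤ q x)
    (h : ∀ x, q x * φ (T x) ≤ ρ * φ x) (n : ℕ) (x : X) :
    (∏ i ∈ Finset.range n, q (T^[i] x)) * φ (T^[n] x) ≤ ρ ^ n * φ x := by
  induction n with
  | zero => simp
  | succ n ih =>
    rw [Finset.prod_range_succ, Function.iterate_succ_apply', mul_assoc]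
    calc _ ≤ (∏ i ∈ Finset.range n, q (T^[i] x)) * (ρ * φ (T^[n] x)) :=
          mul_le_mul_of_nonneg_left (h _) (Finset.prod_nonneg fun i _ => hq0 _)
      _ ≤ ρ ^ (n + 1) * φ x := by
          rw [pow_succ]
          nlinarith [mul_le_mul_of_nonneg_left ih hρ]

variable [CompactSpace X]

/-- By compactness, finitely many return lengths suffice; chopping an orbit segment into pieces of
these lengths makes long products small, uniformly in the base point. -/
lemma exists_prod_iterate_le_half {q : X → ℝ} (hq : Continuous q) (hq0 : ∀ x, 0 < q x)
    (h : ∀ x, ∃ l : ℕ, 1 ≤ l ∧ ∏ i ∈ Finset.range l, q (T^[i] x) < 1 / 2) :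
    ∃ N : ℕ, ∀ x, ∏ i ∈ Finset.range N, q (T^[i] x) ≤ 1 / 2 := by
  set P : ℕ → X → ℝ := fun n x => ∏ i ∈ Finset.range n, q (T^[i] x) with hP
  have hPc : ∀ n, Continuous (P n) := fun n => continuous_prod_iterate hq n
  have hP0 : ∀ n x, 0 < P n x := fun n x => Finset.prod_pos fun i _ => hq0 _
  choose l hl1 hl2 using h
  obtain ⟨t, ht⟩ := CompactSpace.elim_nhds_subcover (fun x => {y | P (l x) y < 1 / 2})
    fun x => (isOpen_lt (hPc (l x)) continuous_const).mem_nhds (hl2 x)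
  set M := t.sup l with hM
  have hcov : ∀ y, ∃ k, 1 ≤ k ∧ k ≤ M ∧ P k y < 1 / 2 := by
    intro y
    have : y ∈ ⋃ x ∈ t, {y | P (l x) y < 1 / 2} := by rw [ht]; trivial
    simp only [Set.mem_iUnion] at this
    obtain ⟨x, hx, hy⟩ := this
    exact ⟨l x, hl1 x, Finset.le_sup hx, hy⟩
  rcases isEmpty_or_nonempty X with hX | ⟨⟨x₀⟩⟩
  · exact ⟨0, fun x => (hX.false x).elim⟩
  have hM1 : 0 < M := by
    obtain ⟨k, h1, h2, _⟩ := hcov x₀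
    omega
  obtain ⟨C, hC⟩ : ∃ C : ℝ, ∀ n < M, ∀ x, P n x ≤ C := by
    have hb : ∀ n, ∃ C : ℝ, ∀ x, P n x ≤ C := fun n => by
      obtain ⟨C, hC⟩ := (isCompact_range (hPc n)).bddAbove
      exact ⟨C, fun x => hC ⟨x, rfl⟩⟩
    choose C hC using hb
    have hCn : ∀ n, 0 ≤ C n := fun n => (hP0 n x₀).le.trans (hC n x₀)
    exact ⟨∑ n ∈ Finset.range M, C n, fun n hn x => (hC n x).trans
      (Finset.single_le_sum (f := C) (fun i _ => hCn i) (Finset.mem_range.2 hn))⟩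
  have hC0 : 0 ≤ C := (hP0 0 x₀).le.trans (hC 0 hM1 x₀)
  have key : ∀ n x, P n x ≤ C * (1 / 2) ^ (n / M) := by
    intro n
    induction n using Nat.strong_induction_on with
    | _ n ih =>
      intro x
      rcases lt_or_ge n M with hn | hn
      · rw [Nat.div_eq_of_lt hn, pow_zero, mul_one]
        exact hC n hn x
      · obtain ⟨k, h1, h2, h3⟩ := hcov x
        have e : n = k + (n - k) := by omega
        have hsplit : P n x = P k x * P (n - k) (T^[k] x) := by
          conv_lhs => rw [e]
          exact prod_range_add_iterate q k (n - k) x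
        have hdiv : n / M ≤ (n - k) / M + 1 := by
          rw [← Nat.add_div_right _ hM1]
          exact Nat.div_le_div_right (by omega)
        calc P n x = P k x * P (n - k) (T^[k] x) := hsplit
          _ ≤ (1 / 2) * (C * (1 / 2) ^ ((n - k) / M)) :=
            mul_le_mul h3.le (ih (n - k) (by omega) _) (hP0 _ _).le (by norm_num)
          _ = C * (1 / 2) ^ ((n - k) / M + 1) := by ring
          _ ≤ C * (1 / 2) ^ (n / M) := mul_le_mul_of_nonneg_left
            (pow_le_pow_of_le_one (by norm_num) (by norm_num) hdiv) hC0
  have hlim : Tendsto (fun k : ℕ => C * (1 / 2 : ℝ) ^ k) atTop (𝓝 (C * 0)) :=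
    (tendsto_pow_atTop_nhds_zero_of_lt_one (by norm_num) (by norm_num)).const_mul C
  rw [mul_zero] at hlim
  obtain ⟨k, hk⟩ := (hlim.eventually (ge_mem_nhds (show (0 : ℝ) < 1 / 2 by norm_num))).exists
  refine ⟨k * M, fun x => (key _ x).trans ?_⟩
  rwa [Nat.mul_div_cancel _ hM1]

/-- A weight `φ` with respect to which `q` contracts in one step. With `P_n = ∏_{i < n} q ∘ Tⁱ` and
`P_N ≤ 1/2`, the weight is `φ = ∑_{n < N} P_n`, since `q · φ ∘ T = φ - 1 + P_N`. -/
lemma exists_adapted_weight {q : X → ℝ} (hq : Continuous q) (hq0 : ∀ x, 0 < q x)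
    (h : ∀ x, ∃ l : ℕ, 1 ≤ l ∧ ∏ i ∈ Finset.range l, q (T^[i] x) < 1 / 2) :
    ∃ φ : X → ℝ, Continuous φ ∧ (∀ x, 0 < φ x) ∧
      ∃ ρ : ℝ, 0 < ρ ∧ ρ < 1 ∧ ∀ x, q x * φ (T x) ≤ ρ * φ x := by
  obtain ⟨N, hN⟩ := exists_prod_iterate_le_half hq hq0 h
  have hP0 : ∀ n x, 0 < ∏ i ∈ Finset.range n, q (T^[i] x) :=
    fun n x => Finset.prod_pos fun i _ => hq0 _
  set φ : X → ℝ := fun x => ∑ n ∈ Finset.range N, ∏ i ∈ Finset.range n, q (T^[i] x) with hφ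
  have hφc : Continuous φ := continuous_finsetSum _ fun n _ => continuous_prod_iterate hq n
  rcases isEmpty_or_nonempty X with hX | ⟨⟨x₀⟩⟩
  · exact ⟨φ, hφc, fun x => (hX.false x).elim, 1 / 2, by norm_num, by norm_num,
      fun x => (hX.false x).elim⟩
  have hstep : ∀ x, q x * φ (T x) = φ x - 1 + ∏ i ∈ Finset.range N, q (T^[i] x) := by
    intro x
    have h1 : q x * φ (T x) =
        ∑ n ∈ Finset.range N, ∏ i ∈ Finset.range (n + 1), q (T^[i] x) := by
      rw [hφ]
      simp only [Finset.mul_sum]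
      refine Finset.sum_congr rfl fun n _ => ?_
      rw [Finset.prod_range_succ', mul_comm]
      rfl
    have h2 := Finset.sum_range_succ' (fun n => ∏ i ∈ Finset.range n, q (T^[i] x)) N
    rw [Finset.sum_range_succ] at h2
    rw [h1]
    simp only [Finset.range_zero, Finset.prod_empty] at h2
    linarith
  have hφ1 : ∀ x, 0 < φ x := by
    intro x
    refine Finset.sum_pos (fun n _ => hP0 n x) ⟨0, Finset.mem_range.2 ?_⟩
    by_contra hcon
    have hN0 : N = 0 := by omega
    have := hN x
    rw [hN0] at this
    norm_num at this
  obtain ⟨K, hK⟩ := (isCompact_range hφc).bddAbove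
  have hK' : ∀ x, φ x ≤ K := fun x => hK ⟨x, rfl⟩
  have hK0 : 0 < K := (hφ1 x₀).trans_le (hK' x₀)
  have hK1 : 1 / 2 < K := by
    have h1 := hstep x₀
    have h2 := mul_pos (hq0 x₀) (hφ1 (T x₀))
    have h3 := hN x₀
    have h4 := hK' x₀
    have h5 := hP0 N x₀
    linarith
  refine ⟨φ, hφc, hφ1, 1 - 1 / (2 * K), ?_, ?_, fun x => ?_⟩
  · rw [sub_pos, div_lt_one (by positivity)]; linarith
  · have : 0 < 1 / (2 * K) := by positivity
    linarith
  · have : 1 / (2 * K) * φ x ≤ 1 / 2 := by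
      rw [div_mul_eq_mul_div, div_le_iff₀ (by positivity)]
      linarith [hK' x]
    rw [hstep]
    linarith [hN x]

end Adapted

/-! ### Continuous line fields -/

section LineFields

variable {X : Type*} [TopologicalSpace X]

lemma continuous_act {A : X → GL (Fin 2) ℝ} (hA : Continuous A) : Continuous fun x => act (A x) := by
  have h : Continuous (Matrix.toEuclideanCLM (n := Fin 2) (𝕜 := ℝ) :
      Matrix (Fin 2) (Fin 2) ℝ → (Plane →L[ℝ] Plane)) :=
    LinearMap.continuous_of_finiteDimensional (IsLinearMap.mk' _
      ⟨map_add (Matrix.toEuclideanCLM (n := Fin 2) (𝕜 := ℝ)), map_smul _⟩)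
  exact h.comp (Units.continuous_val.comp hA)

/-- A function computed from arbitrary nonzero vectors of two continuous line fields is continuous,
even though the vectors may not be chosen continuously on the whole space. -/
lemma continuous_of_lineFields {Z : Type*} [TopologicalSpace Z] {E F : X → Submodule ℝ Plane}
    (hE : IsContinuousLineField E) (hF : IsContinuousLineField F) {g : X → Z}
    {G : X → Plane → Plane → Z}
    (hG : ∀ x v w, v ≠ 0 → w ≠ 0 →
      ContinuousAt (fun p : X × Plane × Plane => G p.1 p.2.1 p.2.2) (x, v, w))
    (hg : ∀ x, ∀ v ∈ E x, ∀ w ∈ F x, v ≠ 0 → w ≠ 0 → g x = G x v w) : Continuous g := by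
  rw [continuous_iff_continuousAt]
  intro x
  obtain ⟨U, hU, v, hv, hEv⟩ := hE x
  obtain ⟨V, hV, w, hw, hFw⟩ := hF x
  have hvx := hv.continuousAt hU
  have hwx := hw.continuousAt hV
  have hcomp : ContinuousAt (fun y => G y (v y) (w y)) x :=
    ContinuousAt.comp (f := fun y => (y, v y, w y))
      (g := fun p : X × Plane × Plane => G p.1 p.2.1 p.2.2)
      (hG x (v x) (w x) (hEv x (mem_of_mem_nhds hU)).1 (hFw x (mem_of_mem_nhds hV)).1)
      (continuousAt_id.prodMk (hvx.prodMk hwx))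
  refine hcomp.congr ?_
  filter_upwards [hU, hV] with y hy1 hy2
  refine (hg y _ ?_ _ ?_ (hEv y hy1).1 (hFw y hy2).1).symm
  · rw [(hEv y hy1).2]; exact Submodule.mem_span_singleton_self _
  · rw [(hFw y hy2).2]; exact Submodule.mem_span_singleton_self _

lemma exists_unit_vector_of_finrank_eq_one {V : Submodule ℝ Plane}
    (hV : Module.finrank ℝ V = 1) : ∃ w : Plane, ‖w‖ = 1 ∧ V = Submodule.span ℝ {w} := by
  obtain ⟨v, hv, hv'⟩ := finrank_eq_one_iff'.1 hV
  have hv0 : (v : Plane) ≠ 0 := fun h => hv (Subtype.ext h)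
  have hn : ‖(v : Plane)‖ ≠ 0 := norm_ne_zero_iff.2 hv0
  refine ⟨‖(v : Plane)‖⁻¹ • (v : Plane), ?_, ?_⟩
  · rw [norm_smul, norm_inv, norm_norm, inv_mul_cancel₀ hn]
  · apply le_antisymm
    · intro z hz
      obtain ⟨c, hc⟩ := hv' ⟨z, hz⟩
      refine Submodule.mem_span_singleton.2 ⟨c * ‖(v : Plane)‖, ?_⟩
      rw [smul_smul, mul_assoc, mul_inv_cancel₀ hn, mul_one]
      exact congrArg Subtype.val hc
    · rw [Submodule.span_singleton_le_iff_mem]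
      exact V.smul_mem _ v.2

variable {T : X ≃ₜ X} {A : X → GL (Fin 2) ℝ}

lemma exists_unit_field {E : X → Submodule ℝ Plane} (h1 : ∀ x, Module.finrank ℝ (E x) = 1)
    (hmap : ∀ x, (E x).map (act (A x)).toLinearMap = E (T x)) :
    ∃ (w : X → Plane) (κ : X → ℝ), (∀ x, ‖w x‖ = 1) ∧ (∀ x, E x = Submodule.span ℝ {w x}) ∧
      (∀ x, act (A x) (w x) = κ x • w (T x)) ∧ ∀ x, κ x ≠ 0 := by
  choose w hw1 hw2 using fun x => exists_unit_vector_of_finrank_eq_one (h1 x)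
  have hex : ∀ x, ∃ k : ℝ, k • w (T x) = act (A x) (w x) := by
    intro x
    rw [← Submodule.mem_span_singleton, ← hw2, ← hmap]
    refine ⟨w x, ?_, rfl⟩
    rw [hw2]; exact Submodule.mem_span_singleton_self _
  choose κ hκ using hex
  refine ⟨w, κ, hw1, hw2, fun x => (hκ x).symm, fun x h0 => ?_⟩
  refine act_apply_ne_zero (A x) (v := w x) (fun h => ?_) (by rw [← hκ, h0, zero_smul])
  have := hw1 x
  rw [h, norm_zero] at this
  exact zero_ne_one this

end LineFields


/-! ### Quasi-conjugation to a lower triangular cocycle -/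

/-- The matrix that takes the second basis vector to `v` and the first one to `v` turned clockwise
by a right angle; it is a rotation if `v` is a unit vector. -/
def frame (v : Plane) : Matrix (Fin 2) (Fin 2) ℝ := !![v 1, v 0; -v 0, v 1]

lemma det_frame (v : Plane) : (frame v).det = ‖v‖ ^ 2 := by
  rw [frame, Matrix.det_fin_two_of, norm_sq_plane]; ring

lemma frame_smul (t : ℝ) (v : Plane) : frame (t • v) = t • frame v := by
  ext i j; fin_cases i <;> fin_cases j <;> simp [frame]

lemma frame_mul_transpose (v : Plane) : frame v * (frame v)ᵀ = ‖v‖ ^ 2 • 1 := by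
  rw [norm_sq_plane]
  ext i j
  fin_cases i <;> fin_cases j <;> simp [frame, Matrix.mul_apply, Fin.sum_univ_two] <;> ring

lemma frame_mem {v : Plane} (hv : ‖v‖ = 1) :
    frame v ∈ Matrix.specialOrthogonalGroup (Fin 2) ℝ := by
  rw [Matrix.mem_specialOrthogonalGroup_iff, Matrix.mem_orthogonalGroup_iff]
  refine ⟨?_, by rw [det_frame, hv, one_pow]⟩
  have := frame_mul_transpose v
  rw [hv, one_pow, one_smul] at this
  rw [← this]

/-- The matrix `M` in the orthonormal frames given by `v` and `M v`. It depends only on the line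
spanned by `v`. -/
noncomputable def conjMatrix (M : GL (Fin 2) ℝ) (v : Plane) : Matrix (Fin 2) (Fin 2) ℝ :=
  (‖act M v‖ * ‖v‖)⁻¹ • ((frame (act M v))ᵀ * (M : Matrix (Fin 2) (Fin 2) ℝ) * frame v)

lemma conjMatrix_smul (M : GL (Fin 2) ℝ) (v : Plane) {t : ℝ} (ht : t ≠ 0) :
    conjMatrix M (t • v) = conjMatrix M v := by
  have h : (|t| * ‖act M v‖ * (|t| * ‖v‖))⁻¹ * (t * t) = (‖act M v‖ * ‖v‖)⁻¹ := by
    have : |t| * ‖act M v‖ * (|t| * ‖v‖) = (t * t) * (‖act M v‖ * ‖v‖) := by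
      rw [← abs_mul_abs_self t]; ring
    rw [this, mul_inv, mul_comm (t * t)⁻¹, mul_assoc, inv_mul_cancel₀ (mul_self_ne_zero.2 ht),
      mul_one]
  rw [conjMatrix, conjMatrix, map_smul, frame_smul, frame_smul, norm_smul, norm_smul,
    Real.norm_eq_abs, Matrix.transpose_smul, Matrix.smul_mul, Matrix.smul_mul, Matrix.mul_smul,
    smul_smul, smul_smul, mul_assoc, h]

lemma conjMatrix_zero_one (M : GL (Fin 2) ℝ) (v : Plane) : conjMatrix M v 0 1 = 0 := by
  have h0 := act_apply_zero M v
  have h1 := act_apply_one M v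
  simp only [conjMatrix, frame, Matrix.smul_apply, Matrix.mul_apply, Fin.sum_univ_two,
    Matrix.transpose_apply, Matrix.of_apply, Matrix.cons_val', Matrix.cons_val_zero,
    Matrix.cons_val_one, Matrix.cons_val_fin_one, smul_eq_mul, h0, h1]
  ring

lemma conjMatrix_one_one (M : GL (Fin 2) ℝ) {v : Plane} (hv : v ≠ 0) :
    conjMatrix M v 1 1 = ‖act M v‖ / ‖v‖ := by
  have h0 := act_apply_zero M v
  have h1 := act_apply_one M v
  have hn := norm_sq_plane (act M v)
  have hv' : ‖v‖ ≠ 0 := norm_ne_zero_iff.2 hv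
  have hMv : ‖act M v‖ ≠ 0 := norm_ne_zero_iff.2 (act_apply_ne_zero M hv)
  have e : conjMatrix M v 1 1 = (‖act M v‖ * ‖v‖)⁻¹ * ‖act M v‖ ^ 2 := by
    rw [hn]
    simp only [conjMatrix, frame, Matrix.smul_apply, Matrix.mul_apply, Fin.sum_univ_two,
      Matrix.transpose_apply, Matrix.of_apply, Matrix.cons_val', Matrix.cons_val_zero,
      Matrix.cons_val_one, Matrix.cons_val_fin_one, smul_eq_mul, h0, h1]
    ring
  rw [e]
  field_simp

lemma det_conjMatrix (M : GL (Fin 2) ℝ) {v : Plane} (hv : v ≠ 0) :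
    (conjMatrix M v).det = (M : Matrix (Fin 2) (Fin 2) ℝ).det := by
  have hv' : ‖v‖ ≠ 0 := norm_ne_zero_iff.2 hv
  have hMv : ‖act M v‖ ≠ 0 := norm_ne_zero_iff.2 (act_apply_ne_zero M hv)
  rw [conjMatrix, Matrix.det_smul, Matrix.det_mul, Matrix.det_mul, Matrix.det_transpose, det_frame,
    det_frame, Fintype.card_fin]
  field_simp

lemma continuous_frame : Continuous frame := by
  unfold frame
  refine continuous_matrix fun i j => ?_
  fin_cases i <;> fin_cases j <;> simp <;> fun_prop

lemma continuous_generalLinearGroup {X : Type*} [TopologicalSpace X] {H : X → GL (Fin 2) ℝ}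
    (h : Continuous fun x => (H x : Matrix (Fin 2) (Fin 2) ℝ)) : Continuous H := by
  refine Units.continuous_iff.2 ⟨h, ?_⟩
  have e : (fun x => ((H x)⁻¹ : GL (Fin 2) ℝ).val) = fun x =>
      (H x : Matrix (Fin 2) (Fin 2) ℝ).det⁻¹ • (H x : Matrix (Fin 2) (Fin 2) ℝ).adjugate := by
    funext x
    rw [Matrix.coe_units_inv, Matrix.inv_def, Ring.inverse_eq_inv']
  rw [e]
  exact (h.matrix_det.inv₀ fun x => (Matrix.GeneralLinearGroup.det_ne_zero (H x))).smul
    h.matrix_adjugate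

section

variable {X : Type*} [TopologicalSpace X] {T : X ≃ₜ X} {A : X → GL (Fin 2) ℝ}

lemma continuousAt_act_apply (hA : Continuous A) (x : X) (v w : Plane) :
    ContinuousAt (fun p : X × Plane × Plane => act (A p.1) p.2.1) (x, v, w) := by
  exact (((continuous_act hA).comp continuous_fst).clm_apply
    (continuous_fst.comp continuous_snd)).continuousAt

/-- A cocycle with a dominated splitting is quasi-conjugated to a continuous lower triangular one
with positive diagonal, for which the ratio of the diagonal entries contracts in a suitable
weight. The second basis vector corresponds to the dominating line. -/
theorem exists_lowerTriangular [CompactSpace X] (hA : Continuous A)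
    (hdet : ∀ x, 0 < (A x : Matrix (Fin 2) (Fin 2) ℝ).det) (hdom : HasDominatedSplitting T A) :
    ∃ (H : X → GL (Fin 2) ℝ) (φ : X → ℝ) (ρ : ℝ), Continuous H ∧ QuasiConjugated T A H ∧
      (∀ x, H x 0 1 = 0) ∧ (∀ x, 0 < H x 0 0) ∧ (∀ x, 0 < H x 1 1) ∧ Continuous φ ∧
      (∀ x, 0 < φ x) ∧ 0 < ρ ∧ ρ < 1 ∧ ∀ x, H x 0 0 * φ (T x) ≤ ρ * φ x * H x 1 1 := by
  obtain ⟨E, F, hEF⟩ := hdom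
  obtain ⟨w₁, κ₁, hw₁, hE, h₁, hκ₁⟩ := exists_unit_field hEF.finrank_E hEF.map_E
  obtain ⟨w₂, κ₂, hw₂, hF, h₂, hκ₂⟩ := exists_unit_field hEF.finrank_F hEF.map_F
  have hw₁0 : ∀ x, w₁ x ≠ 0 := fun x h => by simpa [h] using hw₁ x
  have hw₂0 : ∀ x, w₂ x ≠ 0 := fun x h => by simpa [h] using hw₂ x
  have hn₂ : ∀ x, ‖act (A x) (w₂ x)‖ = |κ₂ x| := fun x => by
    rw [h₂, norm_smul, hw₂, mul_one, Real.norm_eq_abs]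
  have hn₁ : ∀ x, ‖act (A x) (w₁ x)‖ = |κ₁ x| := fun x => by
    rw [h₁, norm_smul, hw₁, mul_one, Real.norm_eq_abs]
  -- up to sign, the sine of the angle between the two lines
  set δ : X → ℝ := fun x => w₁ x 0 * w₂ x 1 - w₁ x 1 * w₂ x 0 with hδ
  have hδ0 : ∀ x, δ x ≠ 0 := by
    intro x h0
    simp only [hδ] at h0
    have hs := norm_sq_plane (w₂ x)
    rw [hw₂, one_pow] at hs
    have hmem : w₁ x ∈ F x := by
      rw [hF, Submodule.mem_span_singleton]
      refine ⟨w₁ x 0 * w₂ x 0 + w₁ x 1 * w₂ x 1, ?_⟩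
      ext i
      fin_cases i
      · simp only [PiLp.smul_apply, smul_eq_mul, Fin.zero_eta]
        linear_combination -(w₁ x 0) * hs - w₂ x 1 * h0
      · simp only [PiLp.smul_apply, smul_eq_mul, Fin.mk_one]
        linear_combination -(w₁ x 1) * hs + w₂ x 0 * h0
    have hmem' : w₁ x ∈ E x := by rw [hE]; exact Submodule.mem_span_singleton_self _
    exact hw₁0 x (Submodule.disjoint_def.1 (hEF.isCompl x).disjoint _ hmem' hmem)
  -- the determinant of `A(x)` compares the areas spanned by the unit vectors at `x` and at `T x`
  have hδT : ∀ x, |κ₁ x| * |κ₂ x| * |δ (T x)| =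
      (A x : Matrix (Fin 2) (Fin 2) ℝ).det * |δ x| := by
    intro x
    have e10 : κ₁ x * w₁ (T x) 0 = _ := (congrArg (fun v : Plane => v 0) (h₁ x)).symm
    have e11 : κ₁ x * w₁ (T x) 1 = _ := (congrArg (fun v : Plane => v 1) (h₁ x)).symm
    have e20 : κ₂ x * w₂ (T x) 0 = _ := (congrArg (fun v : Plane => v 0) (h₂ x)).symm
    have e21 : κ₂ x * w₂ (T x) 1 = _ := (congrArg (fun v : Plane => v 1) (h₂ x)).symm
    simp only [act_apply_zero, act_apply_one] at e10 e11 e20 e21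
    rw [← abs_of_pos (hdet x), ← abs_mul, ← abs_mul, ← abs_mul, Matrix.det_fin_two]
    congr 1
    calc κ₁ x * κ₂ x * δ (T x) = (κ₁ x * w₁ (T x) 0) * (κ₂ x * w₂ (T x) 1) -
          (κ₁ x * w₁ (T x) 1) * (κ₂ x * w₂ (T x) 0) := by simp only [hδ]; ring
      _ = _ := by rw [e10, e11, e20, e21]; simp only [hδ]; ring
  have mem_span : ∀ {w v : Plane}, v ∈ Submodule.span ℝ {w} → v ≠ 0 → ∃ t : ℝ, t ≠ 0 ∧ t • w = v := by
    intro w v hv hv0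
    obtain ⟨t, rfl⟩ := Submodule.mem_span_singleton.1 hv
    exact ⟨t, fun h => hv0 (by rw [h, zero_smul]), rfl⟩
  have hδc : Continuous fun x => |δ x| := by
    refine continuous_of_lineFields hEF.continuous_E hEF.continuous_F
      (G := fun _ v w => |v 0 * w 1 - v 1 * w 0| / (‖v‖ * ‖w‖)) (fun x v w hv hw => ?_)
      (fun x v hv w hw hv0 hw0 => ?_)
    · refine ContinuousAt.div (Continuous.continuousAt (by fun_prop))
        (Continuous.continuousAt (by fun_prop))
        (mul_ne_zero (norm_ne_zero_iff.2 hv) (norm_ne_zero_iff.2 hw))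
    · rw [hE] at hv
      rw [hF] at hw
      obtain ⟨s, hs, rfl⟩ := mem_span hv hv0
      obtain ⟨t, ht, rfl⟩ := mem_span hw hw0
      have hs' : |s| ≠ 0 := abs_ne_zero.2 hs
      have ht' : |t| ≠ 0 := abs_ne_zero.2 ht
      have e : (s • w₁ x) 0 * (t • w₂ x) 1 - (s • w₁ x) 1 * (t • w₂ x) 0 = s * t * δ x := by
        simp only [PiLp.smul_apply, smul_eq_mul, hδ]; ring
      rw [e, norm_smul, norm_smul, hw₁, hw₂, Real.norm_eq_abs, Real.norm_eq_abs, abs_mul, abs_mul]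
      field_simp
  have hκc : ∀ {L : X → Submodule ℝ Plane} {w : X → Plane} {κ : X → ℝ},
      IsContinuousLineField L → (∀ x, ‖w x‖ = 1) → (∀ x, L x = Submodule.span ℝ {w x}) →
      (∀ x, ‖act (A x) (w x)‖ = |κ x|) → Continuous fun x => |κ x| := by
    intro L w κ hL hw hLw hn
    refine continuous_of_lineFields hL hL (G := fun x v _ => ‖act (A x) v‖ / ‖v‖)
      (fun x v v' hv _ => ?_) (fun x v hv _ _ hv0 _ => ?_)
    · exact (continuousAt_act_apply hA x v v').norm.div
        (Continuous.continuousAt (by fun_prop)) (norm_ne_zero_iff.2 hv)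
    · rw [hLw] at hv
      obtain ⟨s, hs, rfl⟩ := mem_span hv hv0
      have hs' : |s| ≠ 0 := abs_ne_zero.2 hs
      rw [map_smul, norm_smul, norm_smul, hn, hw, Real.norm_eq_abs]
      field_simp
  have hκ₁c := hκc hEF.continuous_E hw₁ hE hn₁
  have hκ₂c := hκc hEF.continuous_F hw₂ hF hn₂
  have hκ₁p : ∀ x, 0 < |κ₁ x| := fun x => abs_pos.2 (hκ₁ x)
  have hκ₂p : ∀ x, 0 < |κ₂ x| := fun x => abs_pos.2 (hκ₂ x)
  have hδp : ∀ x, 0 < |δ x| := fun x => abs_pos.2 (hδ0 x)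
  -- The ratio of the multipliers along `E` and `F` differs from the ratio of the diagonal entries of
  -- `H` by the coboundary `|δ ∘ T| / |δ|`; the weight for the former, divided by `|δ|`, serves for
  -- the latter.
  obtain ⟨φ, hφc, hφ0, ρ, hρ0, hρ1, hφ⟩ := exists_adapted_weight (T := T)
    (q := fun x => |κ₁ x| / |κ₂ x|) (hκ₁c.div hκ₂c fun x => (hκ₂p x).ne')
    (fun x => div_pos (hκ₁p x) (hκ₂p x)) (fun x => by
      obtain ⟨l, hl, hlt⟩ := hEF.dominated x
      refine ⟨l, hl, ?_⟩
      rw [hE, hF, restrictNorm_fwd_mul_restrictNorm_bwd h₁ h₂ hw₁0 hw₂0] at hlt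
      simpa [hw₁, hw₂] using hlt)
  have hcd : ∀ x, (conjMatrix (A x) (w₂ x)).det ≠ 0 := fun x => by
    rw [det_conjMatrix _ (hw₂0 x)]; exact (hdet x).ne'
  set H : X → GL (Fin 2) ℝ := fun x =>
    Matrix.GeneralLinearGroup.mkOfDetNeZero (conjMatrix (A x) (w₂ x)) (hcd x) with hH
  have hHval : ∀ x, (H x : Matrix (Fin 2) (Fin 2) ℝ) = conjMatrix (A x) (w₂ x) := fun x => rfl
  have h01 : ∀ x, H x 0 1 = 0 := fun x => conjMatrix_zero_one _ _
  have h11 : ∀ x, H x 1 1 = |κ₂ x| := fun x => by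
    rw [hHval, conjMatrix_one_one _ (hw₂0 x), hn₂, hw₂, div_one]
  have h00 : ∀ x, H x 0 0 * |κ₂ x| = (A x : Matrix (Fin 2) (Fin 2) ℝ).det := fun x => by
    rw [← det_conjMatrix (A x) (hw₂0 x), ← hHval, Matrix.det_fin_two, h01, h11]; ring
  refine ⟨H, fun x => φ x / |δ x|, ρ, ?_, ?_, h01, fun x => ?_, fun x => ?_,
    hφc.div hδc fun x => (hδp x).ne', fun x => div_pos (hφ0 x) (hδp x), hρ0, hρ1, fun x => ?_⟩
  · refine continuous_generalLinearGroup ?_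
    simp only [hHval]
    refine continuous_of_lineFields hEF.continuous_F hEF.continuous_F
      (G := fun x v _ => conjMatrix (A x) v) (fun x v v' hv _ => ?_) (fun x v hv _ _ hv0 _ => ?_)
    · unfold conjMatrix
      have hc := continuousAt_act_apply hA x v v'
      have hfr : ContinuousAt (fun p : X × Plane × Plane => frame (act (A p.1) p.2.1)) (x, v, v') :=
        continuous_frame.continuousAt.comp (f := fun p : X × Plane × Plane => act (A p.1) p.2.1) hc
      have hfr2 : ContinuousAt (fun p : X × Plane × Plane => frame p.2.1) (x, v, v') :=
        (continuous_frame.comp (by fun_prop :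
          Continuous fun p : X × Plane × Plane => p.2.1)).continuousAt
      have hA' : ContinuousAt
          (fun p : X × Plane × Plane => (A p.1 : Matrix (Fin 2) (Fin 2) ℝ)) (x, v, v') :=
        ((Units.continuous_val.comp hA).comp continuous_fst).continuousAt
      have ht : ContinuousAt (fun p : X × Plane × Plane => (frame (act (A p.1) p.2.1))ᵀ)
          (x, v, v') :=
        (continuous_id.matrix_transpose.continuousAt).comp
          (f := fun p : X × Plane × Plane => frame (act (A p.1) p.2.1)) hfr
      refine ContinuousAt.smul (ContinuousAt.inv₀ (hc.norm.mul
        (Continuous.continuousAt (by fun_prop))) ?_) ((ht.mul hA').mul hfr2)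
      exact mul_ne_zero (norm_ne_zero_iff.2 (act_apply_ne_zero _ hv)) (norm_ne_zero_iff.2 hv)
    · rw [hF] at hv
      obtain ⟨s, hs, rfl⟩ := mem_span hv hv0
      rw [conjMatrix_smul _ _ hs]
  -- the sign records whether `A(x)` reverses the chosen unit vectors of `F`
  · set s : X → ℝ := fun x => if 0 < κ₂ x then 1 else -1 with hs
    have hss : ∀ x, s x * s x = 1 := fun x => by simp only [hs]; split_ifs <;> norm_num
    have hsκ : ∀ x, |κ₂ x|⁻¹ * κ₂ x = s x := fun x => by
      simp only [hs]
      split_ifs with h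
      · rw [abs_of_pos h, inv_mul_cancel₀ (hκ₂ x)]
      · rw [abs_of_neg (lt_of_le_of_ne (not_lt.1 h) (hκ₂ x)), inv_neg, neg_mul,
          inv_mul_cancel₀ (hκ₂ x)]
    refine ⟨fun x => frame (w₂ x), fun x => s x • frame (w₂ (T x)), s, fun x => frame_mem (hw₂ x),
      fun x => ?_, fun x => ?_, fun x => ?_, fun x => ?_⟩
    · have hmem := Matrix.mem_specialOrthogonalGroup_iff.1 (frame_mem (hw₂ (T x)))
      rw [Matrix.mem_specialOrthogonalGroup_iff, Matrix.mem_orthogonalGroup_iff]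
      have h1 := (Matrix.mem_orthogonalGroup_iff _ _).1 hmem.1
      refine ⟨?_, ?_⟩
      · beta_reduce
        rw [Matrix.transpose_smul, Matrix.smul_mul, Matrix.mul_smul, smul_smul, hss, one_smul, h1]
      · rw [Matrix.det_smul, hmem.2, Fintype.card_fin, sq, hss, one_mul]
    · simp only [hs]; split_ifs <;> simp
    · have hinv : (s x • frame (w₂ (T x)))⁻¹ = s x • (frame (w₂ (T x)))ᵀ := by
        refine Matrix.inv_eq_right_inv ?_
        rw [Matrix.smul_mul, Matrix.mul_smul, smul_smul, hss, one_smul, frame_mul_transpose, hw₂,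
          one_pow, one_smul]
      rw [hinv, hHval, conjMatrix, hn₂, hw₂, mul_one, h₂, frame_smul, Matrix.transpose_smul,
        Matrix.smul_mul, Matrix.smul_mul, smul_smul, hsκ, Matrix.smul_mul, Matrix.smul_mul]
    · rw [smul_smul, hss, one_smul]
  · exact pos_of_mul_pos_left ((h00 x).symm ▸ hdet x) (hκ₂p x).le
  · rw [h11]; exact hκ₂p x
  · have hkey : H x 0 0 * |δ x| = |κ₁ x| * |δ (T x)| := by
      apply mul_right_cancel₀ (hκ₂p x).ne'
      linear_combination |δ x| * h00 x - hδT x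
    have hx := hφ x
    rw [div_mul_eq_mul_div, div_le_iff₀ (hκ₂p x)] at hx
    rw [h11]
    have hd := hδp x
    have hdT := hδp (T x)
    have e : H x 0 0 = |κ₁ x| * |δ (T x)| / |δ x| := by rw [← hkey]; field_simp
    rw [e]
    calc _ = |κ₁ x| * φ (T x) / |δ x| := by field_simp
      _ ≤ ρ * φ x * |κ₂ x| / |δ x| := by gcongr
      _ = _ := by ring

/-! ### Invariance of the norms of iterates under quasi-conjugation -/

lemma QuasiConjugated.det_eq {H : X → GL (Fin 2) ℝ} (h : QuasiConjugated T A H) (x : X) :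
    (H x : Matrix (Fin 2) (Fin 2) ℝ).det = (A x : Matrix (Fin 2) (Fin 2) ℝ).det := by
  obtain ⟨B, D, s, hB, hD, -, hH, -⟩ := h
  rw [hH, Matrix.det_mul, Matrix.det_mul, Matrix.det_nonsing_inv,
    (Matrix.mem_specialOrthogonalGroup_iff.1 (hB x)).2,
    (Matrix.mem_specialOrthogonalGroup_iff.1 (hD x)).2]
  simp

lemma QuasiConjugated.norm_act_fwd {H : X → GL (Fin 2) ℝ} (h : QuasiConjugated T A H) (n : ℕ)
    (x : X) : ‖act (fwd T A n x)‖ = ‖act (fwd T H n x)‖ := by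
  obtain ⟨B, D, s, hB, hD, hs, hH, hBD⟩ := h
  have hstep : ∀ x, B (T x) * (H x : Matrix (Fin 2) (Fin 2) ℝ) =
      s x • ((A x : Matrix (Fin 2) (Fin 2) ℝ) * B x) := by
    intro x
    have hdet : IsUnit (D x).det := by
      rw [(Matrix.mem_specialOrthogonalGroup_iff.1 (hD x)).2]; exact isUnit_one
    rw [hBD, hH, Matrix.smul_mul, ← Matrix.mul_assoc, ← Matrix.mul_assoc,
      Matrix.mul_nonsing_inv _ hdet, Matrix.one_mul]
  have key : ∃ r : ℝ, |r| = 1 ∧ B (T^[n] x) * (fwd T H n x : Matrix (Fin 2) (Fin 2) ℝ) =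
      r • ((fwd T A n x : Matrix (Fin 2) (Fin 2) ℝ) * B x) := by
    induction n with
    | zero => exact ⟨1, abs_one, by simp [fwd]⟩
    | succ n ih =>
      obtain ⟨r, hr, e⟩ := ih
      refine ⟨s (T^[n] x) * r, ?_, ?_⟩
      · rw [abs_mul, hr, mul_one]
        rcases hs (T^[n] x) with h | h <;> simp [h]
      · rw [fwd, fwd, Units.val_mul, Units.val_mul, Function.iterate_succ_apply', ← mul_assoc,
          hstep, Matrix.smul_mul, Matrix.mul_assoc, e, Matrix.mul_smul, smul_smul,
          Matrix.mul_assoc]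
  obtain ⟨r, hr, e⟩ := key
  have e' := congrArg (fun M => ‖Matrix.toEuclideanCLM (n := Fin 2) (𝕜 := ℝ) M‖) e
  simp only [map_mul, map_smul, norm_smul, Real.norm_eq_abs, hr, one_mul] at e'
  rw [CStarRing.norm_mem_unitary_mul _ (toEuclideanCLM_mem_unitary (hB _)),
    CStarRing.norm_mul_mem_unitary _ (toEuclideanCLM_mem_unitary (hB _))] at e'
  exact e'.symm

/-- Rotations of the plane commute. -/
lemma QuasiConjugated.rotated {H : X → GL (Fin 2) ℝ} (h : QuasiConjugated T A H) (θ : ℝ) :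
    QuasiConjugated T (RotatedCocycle.rotated A θ) (RotatedCocycle.rotated H θ) := by
  obtain ⟨B, D, s, hB, hD, hs, hH, hBD⟩ := h
  refine ⟨B, D, s, hB, hD, hs, fun x => ?_, hBD⟩
  have hcomm : B x * (rotation θ : Matrix (Fin 2) (Fin 2) ℝ) =
      (rotation θ : Matrix (Fin 2) (Fin 2) ℝ) * B x := by
    obtain ⟨ho, hd⟩ := Matrix.mem_specialOrthogonalGroup_iff.1 (hB x)
    have hinv : (B x)⁻¹ = (B x)ᵀ :=
      Matrix.inv_eq_right_inv ((Matrix.mem_orthogonalGroup_iff _ _).1 ho)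
    rw [Matrix.inv_def, hd, Ring.inverse_one, one_smul, Matrix.adjugate_fin_two] at hinv
    have h1 : B x 1 1 = B x 0 0 := by simpa using congrFun (congrFun hinv 0) 0
    have h2 : -B x 0 1 = B x 1 0 := by simpa using congrFun (congrFun hinv 0) 1
    ext i j
    fin_cases i <;> fin_cases j <;>
      simp [rotation, Matrix.mul_apply, Fin.sum_univ_two, h1, ← h2] <;> ring
  rw [RotatedCocycle.rotated, RotatedCocycle.rotated, Units.val_mul, Units.val_mul, hH,
    Matrix.mul_assoc, hcomm]
  simp only [Matrix.mul_assoc]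

end


/-! ### An analytic implicit function theorem -/

/-- The local inverse of `(θ, v) ↦ (θ, Φ (θ, v))` is analytic. -/
theorem exists_analyticAt_implicit {V : Type*} [NormedAddCommGroup V] [NormedSpace ℝ V]
    [CompleteSpace V] {Φ : ℝ × V → V} {v₀ : V} (hΦ : AnalyticAt ℝ Φ (0, v₀))
    (h₀ : Φ (0, v₀) = 0) {L : V →L[ℝ] V} (hL : IsUnit L)
    (hder : HasFDerivAt (fun v => Φ (0, v)) L v₀) :
    ∃ ψ : ℝ → V, AnalyticAt ℝ ψ 0 ∧ ψ 0 = v₀ ∧ ∀ᶠ θ in 𝓝 0, Φ (θ, ψ θ) = 0 := by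
  set Φ' := fderiv ℝ Φ (0, v₀) with hΦ'
  have hd : HasFDerivAt Φ Φ' (0, v₀) := hΦ.differentiableAt.hasFDerivAt
  have hinr : ∀ v, Φ' (0, v) = L v := by
    have h1 : HasFDerivAt (fun v => Φ (0, v)) (Φ'.comp (ContinuousLinearMap.inr ℝ ℝ V)) v₀ :=
      hd.comp v₀ (hasFDerivAt_prodMk_right (0 : ℝ) v₀)
    intro v
    rw [← h1.unique hder]
    rfl
  obtain ⟨U, rfl⟩ := hL
  have hinv1 : ∀ v, (↑U⁻¹ : V →L[ℝ] V) ((U : V →L[ℝ] V) v) = v := fun v => by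
    rw [← mul_apply_eq_comp, Units.inv_mul]; rfl
  have hinv2 : ∀ v, (U : V →L[ℝ] V) ((↑U⁻¹ : V →L[ℝ] V) v) = v := fun v => by
    rw [← mul_apply_eq_comp, Units.mul_inv]; rfl
  have hsplit : ∀ t v, Φ' (t, v) = Φ' (t, 0) + (U : V →L[ℝ] V) v := fun t v => by
    rw [← hinr, ← map_add, Prod.mk_add_mk, add_zero, zero_add]
  set G : ℝ × V → ℝ × V := fun z => (z.1, Φ z) with hG
  have hGan : AnalyticAt ℝ G (0, v₀) := analyticAt_fst.prod hΦ
  have hGd : HasFDerivAt G ((ContinuousLinearMap.fst ℝ ℝ V).prod Φ') (0, v₀) :=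
    hasFDerivAt_fst.prodMk hd
  let e : (ℝ × V) ≃L[ℝ] (ℝ × V) := ContinuousLinearEquiv.equivOfInverse
    ((ContinuousLinearMap.fst ℝ ℝ V).prod Φ')
    ((ContinuousLinearMap.fst ℝ ℝ V).prod ((↑U⁻¹ : V →L[ℝ] V).comp
      (ContinuousLinearMap.snd ℝ ℝ V - (Φ'.comp (ContinuousLinearMap.inl ℝ ℝ V)).comp
        (ContinuousLinearMap.fst ℝ ℝ V))))
    (fun z => by
      obtain ⟨t, v⟩ := z
      simp [hsplit t v, hinv1])
    (fun z => by
      obtain ⟨t, v⟩ := z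
      simp only [ContinuousLinearMap.prod_apply, ContinuousLinearMap.coe_fst',
        ContinuousLinearMap.comp_apply, sub_apply,
        ContinuousLinearMap.coe_snd', ContinuousLinearMap.inl_apply]
      rw [hsplit, hinv2, add_sub_cancel])
  have hGe : HasFDerivAt G (e : (ℝ × V) →L[ℝ] (ℝ × V)) (0, v₀) := hGd
  have hGc : ContDiffAt ℝ ⊤ G (0, v₀) := hGan.contDiffAt
  have hne : (⊤ : WithTop ℕ∞) ≠ 0 := by simp
  have hG0 : G (0, v₀) = (0, 0) := by simp [hG, h₀]
  set F := hGc.localInverse hGe hne with hF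
  have hFan : AnalyticAt ℝ F (0, 0) := by
    rw [← hG0]
    exact (hGc.to_localInverse hGe hne).analyticAt
  have hF0 : F (0, 0) = (0, v₀) := by
    rw [← hG0]; exact hGc.localInverse_apply_image hGe hne
  have hright : ∀ᶠ z in 𝓝 ((0 : ℝ), (0 : V)), G (F z) = z := by
    rw [← hG0]
    exact (hGc.hasStrictFDerivAt' hGe hne).eventually_right_inverse
  have hι : AnalyticAt ℝ (fun θ : ℝ => (θ, (0 : V))) 0 := analyticAt_id.prod analyticAt_const
  refine ⟨fun θ => (F (θ, 0)).2, ?_, congrArg Prod.snd hF0, ?_⟩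
  · exact analyticAt_snd.comp (AnalyticAt.comp (f := fun θ : ℝ => (θ, (0 : V))) hFan hι)
  · have hc : Tendsto (fun θ : ℝ => (θ, (0 : V))) (𝓝 0) (𝓝 (0, 0)) := hι.continuousAt
    filter_upwards [hc.eventually hright] with θ hθ
    have h1 : (F (θ, 0)).1 = θ := congrArg Prod.fst hθ
    have h2 : Φ (F (θ, 0)) = 0 := congrArg Prod.snd hθ
    have h3 : (θ, (F (θ, 0)).2) = F (θ, 0) := Prod.ext h1.symm rfl
    exact (congrArg Φ h3).trans h2

/-! ### Weighted transfer operators on continuous functions -/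

section Operators

variable {X : Type*} [TopologicalSpace X] [CompactSpace X]

/-- Composition with a homeomorphism, as an operator on continuous functions. -/
noncomputable def koopman (T : X ≃ₜ X) : C(X, ℝ) →L[ℝ] C(X, ℝ) :=
  LinearMap.mkContinuous
    { toFun := fun f => f.comp (T : C(X, X))
      map_add' := fun _ _ => rfl
      map_smul' := fun _ _ => rfl } 1 fun f => by
    rw [one_mul]
    exact (ContinuousMap.norm_le _ (norm_nonneg _)).2 fun x => f.norm_coe_le_norm _

@[simp] lemma koopman_apply (T : X ≃ₜ X) (f : C(X, ℝ)) (x : X) : koopman T f x = f (T x) := rfl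

lemma isUnit_koopman (T : X ≃ₜ X) : IsUnit (koopman T) :=
  ⟨⟨koopman T, koopman T.symm, by ext f x; simp, by ext f x; simp⟩, rfl⟩

/-- Multiplication by a continuous function. -/
noncomputable abbrev mulOp (f : C(X, ℝ)) : C(X, ℝ) →L[ℝ] C(X, ℝ) :=
  ContinuousLinearMap.mul ℝ C(X, ℝ) f

/-- The pointwise inverse of a nowhere vanishing continuous function. -/
noncomputable def invFun (f : C(X, ℝ)) (hf : ∀ x, f x ≠ 0) : C(X, ℝ) :=
  ⟨fun x => (f x)⁻¹, f.continuous.inv₀ hf⟩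

lemma isUnit_mulOp {f : C(X, ℝ)} (hf : ∀ x, f x ≠ 0) : IsUnit (mulOp f) :=
  ⟨⟨mulOp f, mulOp (invFun f hf), by ext g x; simp [invFun, hf x],
    by ext g x; simp [invFun, hf x]⟩, rfl⟩

lemma isUnit_one_sub_of_norm_le {V : Type*} [NormedAddCommGroup V] [NormedSpace ℝ V]
    [CompleteSpace V] {K : V →L[ℝ] V} {ρ : ℝ} (hρ : ρ < 1) (h : ‖K‖ ≤ ρ) : IsUnit (1 - K) :=
  ⟨Units.oneSub K (h.trans_lt hρ), rfl⟩

variable {T : X ≃ₜ X} {p d φ : C(X, ℝ)} {ρ : ℝ}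

/-- The ratio `p / d` measured in the weight `φ`. -/
noncomputable def weightedRatio (T : X ≃ₜ X) (p : C(X, ℝ)) {d φ : C(X, ℝ)} (hd : ∀ x, d x ≠ 0)
    (hφ : ∀ x, φ x ≠ 0) : C(X, ℝ) :=
  p * koopman T φ * invFun d hd * invFun φ hφ

lemma norm_weightedRatio_mul_le (hp : ∀ x, 0 < p x) (hd : ∀ x, 0 < d x) (hφ : ∀ x, 0 < φ x)
    (hρ : 0 ≤ ρ) (h : ∀ x, p x * φ (T x) ≤ ρ * φ x * d x) (x : X) (g : C(X, ℝ)) (y : X) :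
    ‖weightedRatio T p (fun x => (hd x).ne') (fun x => (hφ x).ne') x * g y‖ ≤ ρ * ‖g‖ := by
  have h1 : weightedRatio T p (fun x => (hd x).ne') (fun x => (hφ x).ne') x =
      p x * φ (T x) / (φ x * d x) := by
    simp only [weightedRatio, invFun, ContinuousMap.mul_apply, koopman_apply, ContinuousMap.coe_mk]
    rw [div_eq_mul_inv, mul_inv]; ring
  have h2 : p x * φ (T x) / (φ x * d x) ≤ ρ := by
    rw [div_le_iff₀ (mul_pos (hφ x) (hd x)), ← mul_assoc]; exact h x
  rw [norm_mul, h1, Real.norm_of_nonneg (div_pos (mul_pos (hp x) (hφ _))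
    (mul_pos (hφ x) (hd x))).le]
  exact mul_le_mul h2 (g.norm_coe_le_norm y) (norm_nonneg _) hρ

/-- The linearized equation of the dominating direction, solved along the past. -/
lemma isUnit_backward_transfer (hp : ∀ x, 0 < p x) (hd : ∀ x, 0 < d x) (hφ : ∀ x, 0 < φ x)
    (hρ : 0 ≤ ρ) (hρ1 : ρ < 1) (h : ∀ x, p x * φ (T x) ≤ ρ * φ x * d x) :
    IsUnit (mulOp d * koopman T - mulOp p) := by
  have hφ' : ∀ x, φ x ≠ 0 := fun x => (hφ x).ne'
  have hd' : ∀ x, d x ≠ 0 := fun x => (hd x).ne'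
  set q := weightedRatio T p hd' hφ' with hq
  have hK : ‖koopman T.symm * mulOp q‖ ≤ ρ := by
    refine ContinuousLinearMap.opNorm_le_bound _ hρ fun g => ?_
    refine (ContinuousMap.norm_le _ (by positivity)).2 fun x => ?_
    exact norm_weightedRatio_mul_le hp hd hφ hρ h _ g _
  have e : mulOp d * koopman T - mulOp p =
      mulOp d * mulOp (invFun (koopman T φ) fun x => hφ' (T x)) * koopman T *
        (1 - koopman T.symm * mulOp q) * mulOp φ := by
    ext g x
    have h1 := hφ' x
    have h2 := hd' x
    have h3 := hφ' (T x)
    simp [hq, weightedRatio, invFun]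
    field_simp
  rw [e]
  exact ((((isUnit_mulOp hd').mul (isUnit_mulOp fun x => inv_ne_zero (hφ' (T x)))).mul
    (isUnit_koopman T)).mul
    (isUnit_one_sub_of_norm_le hρ1 hK)).mul (isUnit_mulOp hφ')

/-- The linearized equation of the dominated direction, solved along the future. -/
lemma isUnit_forward_transfer (hp : ∀ x, 0 < p x) (hd : ∀ x, 0 < d x) (hφ : ∀ x, 0 < φ x)
    (hρ : 0 ≤ ρ) (hρ1 : ρ < 1) (h : ∀ x, p x * φ (T x) ≤ ρ * φ x * d x) :
    IsUnit (mulOp p * koopman T - mulOp d) := by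
  have hφ' : ∀ x, φ x ≠ 0 := fun x => (hφ x).ne'
  have hd' : ∀ x, d x ≠ 0 := fun x => (hd x).ne'
  set q := weightedRatio T p hd' hφ' with hq
  have hK : ‖mulOp q * koopman T‖ ≤ ρ := by
    refine ContinuousLinearMap.opNorm_le_bound _ hρ fun g => ?_
    refine (ContinuousMap.norm_le _ (by positivity)).2 fun x => ?_
    exact norm_weightedRatio_mul_le hp hd hφ hρ h _ g _
  have e : mulOp p * koopman T - mulOp d =
      -(mulOp d * mulOp φ * (1 - mulOp q * koopman T) * mulOp (invFun φ hφ')) := by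
    ext g x
    have h1 := hφ' x
    have h2 := hd' x
    have h3 := hφ' (T x)
    simp [hq, weightedRatio, invFun]
    field_simp
    ring
  rw [e]
  exact ((((isUnit_mulOp hd').mul (isUnit_mulOp hφ')).mul
    (isUnit_one_sub_of_norm_le hρ1 hK)).mul (isUnit_mulOp fun x => inv_ne_zero (hφ' x))).neg

/-! ### Analytic families of invariant directions -/

lemma exp_continuousMap_apply (f : C(X, ℝ)) (x : X) :
    (NormedSpace.exp f) x = Real.exp (f x) := by
  have h := NormedSpace.map_exp (ContinuousMap.evalAlgHom ℝ ℝ x) (continuous_eval_const x) f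
  rw [Real.exp_eq_exp_ℝ]
  exact h

lemma analyticAt_cos_smul_add_sin_smul {E : Type*} [NormedAddCommGroup E] [NormedSpace ℝ E]
    (f g : C(X, ℝ)) (z : ℝ × E) :
    AnalyticAt ℝ (fun z : ℝ × E => Real.cos z.1 • f + Real.sin z.1 • g) z :=
  ((AnalyticAt.fun_comp Real.analyticAt_cos analyticAt_fst).smul analyticAt_const).add
    ((AnalyticAt.fun_comp Real.analyticAt_sin analyticAt_fst).smul analyticAt_const)

lemma analyticAt_cos_smul_sub_sin_smul {E : Type*} [NormedAddCommGroup E] [NormedSpace ℝ E]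
    (f g : C(X, ℝ)) (z : ℝ × E) :
    AnalyticAt ℝ (fun z : ℝ × E => Real.cos z.1 • f - Real.sin z.1 • g) z :=
  ((AnalyticAt.fun_comp Real.analyticAt_cos analyticAt_fst).smul analyticAt_const).sub
    ((AnalyticAt.fun_comp Real.analyticAt_sin analyticAt_fst).smul analyticAt_const)

lemma analyticAt_koopman_snd (z : ℝ × C(X, ℝ)) :
    AnalyticAt ℝ (fun z : ℝ × C(X, ℝ) => koopman T z.2) z :=
  AnalyticAt.fun_comp ((koopman T).analyticAt _) analyticAt_snd

/-- The line field spanned by `(u, 1)` is invariant: the fraction that gives its image slope is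
cleared of denominators, so that the equation is polynomial in `u`. -/
lemma exists_analyticAt_dominating_direction (r : C(X, ℝ)) (hp : ∀ x, 0 < p x) (hd : ∀ x, 0 < d x)
    (hφ : ∀ x, 0 < φ x) (hρ : 0 ≤ ρ) (hρ1 : ρ < 1) (h : ∀ x, p x * φ (T x) ≤ ρ * φ x * d x) :
    ∃ u : ℝ → C(X, ℝ), AnalyticAt ℝ u 0 ∧ u 0 = 0 ∧ ∀ᶠ θ in 𝓝 (0 : ℝ),
      ((Real.cos θ • r + Real.sin θ • d) * u θ + (Real.cos θ • d - Real.sin θ • r)) *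
        koopman T (u θ) = Real.cos θ • p * u θ - Real.sin θ • p := by
  obtain ⟨u, h1, h2, h3⟩ := exists_analyticAt_implicit (v₀ := (0 : C(X, ℝ)))
    (Φ := fun z : ℝ × C(X, ℝ) =>
      ((Real.cos z.1 • r + Real.sin z.1 • d) * z.2 + (Real.cos z.1 • d - Real.sin z.1 • r)) *
        koopman T z.2 - (Real.cos z.1 • p * z.2 - Real.sin z.1 • p))
    ((((((analyticAt_cos_smul_add_sin_smul r d _).mul analyticAt_snd).add
      (analyticAt_cos_smul_sub_sin_smul d r _)).mul (analyticAt_koopman_snd _))).sub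
      ((((AnalyticAt.fun_comp Real.analyticAt_cos analyticAt_fst).smul analyticAt_const).mul
        analyticAt_snd).sub
        ((AnalyticAt.fun_comp Real.analyticAt_sin analyticAt_fst).smul analyticAt_const))) (by simp)
    (isUnit_backward_transfer hp hd hφ hρ hρ1 h) (by
      have h1 : HasFDerivAt (fun v : C(X, ℝ) => r * v + d) (mulOp r) 0 :=
        (mulOp r).hasFDerivAt.add_const d
      have h2 := (h1.mul (koopman T).hasFDerivAt).sub ((mulOp p).hasFDerivAt (x := 0))
      convert h2 using 1
      · funext v; simp
      · ext g x; simp)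
  exact ⟨u, h1, h2, h3.mono fun θ hθ => sub_eq_zero.1 hθ⟩

/-- The line field spanned by `(1, e)` is invariant. The value of `e` at `θ = 0` need not vanish; it
solves a linear equation with the same operator as the linearized one. -/
lemma exists_analyticAt_dominated_direction (r : C(X, ℝ)) (hp : ∀ x, 0 < p x) (hd : ∀ x, 0 < d x)
    (hφ : ∀ x, 0 < φ x) (hρ : 0 ≤ ρ) (hρ1 : ρ < 1) (h : ∀ x, p x * φ (T x) ≤ ρ * φ x * d x) :
    ∃ e : ℝ → C(X, ℝ), AnalyticAt ℝ e 0 ∧ ∀ᶠ θ in 𝓝 (0 : ℝ),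
      (Real.cos θ • p - Real.sin θ • p * e θ) * koopman T (e θ) =
        (Real.cos θ • r + Real.sin θ • d) + (Real.cos θ • d - Real.sin θ • r) * e θ := by
  have hu := isUnit_forward_transfer hp hd hφ hρ hρ1 h
  obtain ⟨e₀, he₀⟩ : ∃ e₀, (mulOp p * koopman T - mulOp d) e₀ = r := by
    obtain ⟨U, hU⟩ := hu
    refine ⟨(↑U⁻¹ : C(X, ℝ) →L[ℝ] C(X, ℝ)) r, ?_⟩
    rw [← hU, ← mul_apply_eq_comp, Units.mul_inv]; rfl
  have he₀' : p * koopman T e₀ - d * e₀ = r := he₀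
  obtain ⟨e, h1, h2, h3⟩ := exists_analyticAt_implicit (v₀ := e₀)
    (Φ := fun z : ℝ × C(X, ℝ) =>
      (Real.cos z.1 • p - Real.sin z.1 • p * z.2) * koopman T z.2 -
        ((Real.cos z.1 • r + Real.sin z.1 • d) + (Real.cos z.1 • d - Real.sin z.1 • r) * z.2))
    (((((AnalyticAt.fun_comp Real.analyticAt_cos analyticAt_fst).smul analyticAt_const).sub
      (((AnalyticAt.fun_comp Real.analyticAt_sin analyticAt_fst).smul analyticAt_const).mul
        analyticAt_snd)).mul (analyticAt_koopman_snd _)).sub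
      ((analyticAt_cos_smul_add_sin_smul r d _).add
        ((analyticAt_cos_smul_sub_sin_smul d r _).mul analyticAt_snd))) (by
      simp only [Real.cos_zero, Real.sin_zero, one_smul, zero_smul, zero_mul, sub_zero, add_zero]
      rw [← sub_sub, sub_right_comm, he₀', sub_self]) hu (by
      have h2 := ((mulOp p * koopman T - mulOp d).hasFDerivAt (x := e₀)).sub_const r
      convert h2 using 1
      funext v
      ext x
      simp
      ring)
  exact ⟨e, h1, h3.mono fun θ hθ => sub_eq_zero.1 hθ⟩

/-- An analytic curve of continuous functions, positive at the origin, has an analytic logarithm. -/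
lemma exists_analyticAt_log {m : ℝ → C(X, ℝ)} (hm : AnalyticAt ℝ m 0) (hm0 : ∀ x, 0 < m 0 x) :
    ∃ l : ℝ → C(X, ℝ), AnalyticAt ℝ l 0 ∧ ∀ᶠ θ in 𝓝 (0 : ℝ), ∀ x, Real.exp (l θ x) = m θ x := by
  set l₀ : C(X, ℝ) := ⟨fun x => Real.log (m 0 x), (m 0).continuous.log fun x => (hm0 x).ne'⟩
    with hl₀
  have hexp : NormedSpace.exp l₀ = m 0 := by
    ext x
    rw [exp_continuousMap_apply]
    exact Real.exp_log (hm0 x)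
  have han : AnalyticAt ℝ (fun z : ℝ × C(X, ℝ) => NormedSpace.exp z.2 - m z.1) (0, l₀) := by
    refine AnalyticAt.sub ?_ ?_
    · exact AnalyticAt.comp (f := fun z : ℝ × C(X, ℝ) => z.2) (NormedSpace.exp_analytic _)
        analyticAt_snd
    · exact AnalyticAt.comp (f := fun z : ℝ × C(X, ℝ) => z.1) hm analyticAt_fst
  obtain ⟨l, h1, -, h3⟩ := exists_analyticAt_implicit han (by simp [hexp])
    (isUnit_mulOp (f := m 0) fun x => (hm0 x).ne') (by
      have h := (hasFDerivAt_exp (𝕂 := ℝ) (x := l₀)).sub_const (m 0)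
      convert h using 1
      ext g x
      simp [hexp])
  refine ⟨l, h1, h3.mono fun θ hθ x => ?_⟩
  rw [← exp_continuousMap_apply, sub_eq_zero.1 hθ]

lemma eventually_forall_pos {F : ℝ → C(X, ℝ)} (hF : ContinuousAt F 0) (h0 : ∀ x, 0 < F 0 x) :
    ∀ᶠ θ in 𝓝 (0 : ℝ), ∀ x, 0 < F θ x := by
  have hopen : IsOpen {f : C(X, ℝ) | ∀ x, 0 < f x} := by
    have := ContinuousMap.isOpen_setOfPred_mapsTo (X := X) (Y := ℝ) isCompact_univ
      (isOpen_Ioi (a := (0 : ℝ)))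
    simpa [Set.MapsTo] using this
  exact hF.eventually (hopen.mem_nhds h0)

end Operators


/-! ### Second-order jets -/

/-- `f` is analytic at the origin, with value `a`, derivative `b` and second derivative `c`
there. -/
structure HasJet (f : ℝ → ℝ) (a b c : ℝ) : Prop where
  analyticAt : AnalyticAt ℝ f 0
  value : f 0 = a
  deriv_eq : deriv f 0 = b
  deriv_deriv_eq : deriv (deriv f) 0 = c

namespace HasJet

variable {f g : ℝ → ℝ} {a b c a' b' c' : ℝ}

lemma unique (hf : HasJet f a b c) (hg : HasJet g a' b' c') (h : f =ᶠ[𝓝 0] g) :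
    a = a' ∧ b = b' ∧ c = c' := by
  refine ⟨?_, ?_, ?_⟩
  · rw [← hf.value, ← hg.value, h.eq_of_nhds]
  · rw [← hf.deriv_eq, ← hg.deriv_eq, h.deriv_eq]
  · rw [← hf.deriv_deriv_eq, ← hg.deriv_deriv_eq, h.deriv.deriv_eq]

lemma add (hf : HasJet f a b c) (hg : HasJet g a' b' c') :
    HasJet (fun t => f t + g t) (a + a') (b + b') (c + c') := by
  have h : deriv (fun t => f t + g t) =ᶠ[𝓝 0] fun t => deriv f t + deriv g t := by
    filter_upwards [hf.analyticAt.eventually_analyticAt, hg.analyticAt.eventually_analyticAt]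
      with t h1 h2
    exact deriv_fun_add h1.differentiableAt h2.differentiableAt
  refine ⟨hf.analyticAt.add hg.analyticAt, by rw [hf.value, hg.value], ?_, ?_⟩
  · rw [h.eq_of_nhds, hf.deriv_eq, hg.deriv_eq]
  · rw [h.deriv_eq, deriv_fun_add hf.analyticAt.deriv.differentiableAt
      hg.analyticAt.deriv.differentiableAt, hf.deriv_deriv_eq, hg.deriv_deriv_eq]

lemma mul (hf : HasJet f a b c) (hg : HasJet g a' b' c') :
    HasJet (fun t => f t * g t) (a * a') (b * a' + a * b') (c * a' + 2 * b * b' + a * c') := by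
  have h : deriv (fun t => f t * g t) =ᶠ[𝓝 0] fun t => deriv f t * g t + f t * deriv g t := by
    filter_upwards [hf.analyticAt.eventually_analyticAt, hg.analyticAt.eventually_analyticAt]
      with t h1 h2
    exact deriv_fun_mul h1.differentiableAt h2.differentiableAt
  have hf0 := hf.analyticAt.differentiableAt
  have hg0 := hg.analyticAt.differentiableAt
  have hf1 := hf.analyticAt.deriv.differentiableAt
  have hg1 := hg.analyticAt.deriv.differentiableAt
  refine ⟨hf.analyticAt.mul hg.analyticAt, by rw [hf.value, hg.value], ?_, ?_⟩
  · rw [h.eq_of_nhds, hf.deriv_eq, hg.deriv_eq, hf.value, hg.value]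
  · rw [h.deriv_eq, deriv_fun_add (hf1.fun_mul hg0) (hf0.fun_mul hg1), deriv_fun_mul hf1 hg0,
      deriv_fun_mul hf0 hg1, hf.deriv_eq, hg.deriv_eq, hf.value, hg.value, hf.deriv_deriv_eq,
      hg.deriv_deriv_eq]
    ring

lemma const (k : ℝ) : HasJet (fun _ => k) k 0 0 :=
  ⟨analyticAt_const, rfl, by simp, by simp⟩

lemma cos : HasJet Real.cos 1 0 (-1) := by
  refine ⟨Real.analyticAt_cos, Real.cos_zero, by simp, ?_⟩
  simp [Real.deriv_cos']

lemma sin : HasJet Real.sin 0 1 0 := by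
  refine ⟨Real.analyticAt_sin, Real.sin_zero, by simp, ?_⟩
  simp [Real.deriv_sin]

lemma exp (hf : HasJet f a b c) :
    HasJet (fun t => Real.exp (f t)) (Real.exp a) (Real.exp a * b)
      (Real.exp a * b * b + Real.exp a * c) := by
  have han : AnalyticAt ℝ (fun t => Real.exp (f t)) 0 := hf.analyticAt.rexp
  have h : deriv (fun t => Real.exp (f t)) =ᶠ[𝓝 0] fun t => Real.exp (f t) * deriv f t := by
    filter_upwards [hf.analyticAt.eventually_analyticAt] with t h1
    exact deriv_exp h1.differentiableAt
  have h1 : deriv (fun t => Real.exp (f t)) 0 = Real.exp a * b := by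
    rw [h.eq_of_nhds, hf.value, hf.deriv_eq]
  refine ⟨han, by rw [hf.value], h1, ?_⟩
  rw [h.deriv_eq, deriv_fun_mul han.differentiableAt hf.analyticAt.deriv.differentiableAt, h1,
    hf.value, hf.deriv_eq, hf.deriv_deriv_eq]

lemma of_clm {V : Type*} [NormedAddCommGroup V] [NormedSpace ℝ V] [CompleteSpace V] {F : ℝ → V}
    (hF : AnalyticAt ℝ F 0) (Λ : V →L[ℝ] ℝ) :
    HasJet (fun t => Λ (F t)) (Λ (F 0)) (Λ (deriv F 0)) (Λ (deriv (deriv F) 0)) := by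
  have h : deriv (fun t => Λ (F t)) =ᶠ[𝓝 0] fun t => Λ (deriv F t) := by
    filter_upwards [hF.eventually_analyticAt] with t h1
    exact (Λ.hasFDerivAt.comp_hasDerivAt t h1.differentiableAt.hasDerivAt).deriv
  refine ⟨AnalyticAt.fun_comp (Λ.analyticAt _) hF, rfl, h.eq_of_nhds, ?_⟩
  rw [h.deriv_eq]
  exact (Λ.hasFDerivAt.comp_hasDerivAt 0 hF.deriv.differentiableAt.hasDerivAt).deriv

end HasJet

/-- The jets at the origin of the direction `u` at a point, of the direction `u₁` at its image, and
of the logarithm `l` of the expansion along `u`. -/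
lemma jet_relations {u u₁ l : ℝ → ℝ} {p r d v y v₁ y₁ l₀ l₁ l₂ : ℝ} (hu : HasJet u 0 v y)
    (hu₁ : HasJet u₁ 0 v₁ y₁) (hl : HasJet l l₀ l₁ l₂)
    (h1 : ∀ᶠ t in 𝓝 (0 : ℝ), Real.exp (l t) =
      (Real.cos t * r + Real.sin t * d) * u t + (Real.cos t * d - Real.sin t * r))
    (h2 : ∀ᶠ t in 𝓝 (0 : ℝ), Real.exp (l t) * u₁ t = Real.cos t * p * u t - Real.sin t * p) :
    d * l₁ = r * (v - 1) ∧ d * (l₁ * l₁ + l₂) = 2 * d * v + r * y - d ∧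
      d * v₁ = p * v - p ∧ d * y₁ = p * y - 2 * (d * l₁) * v₁ := by
  have hc := HasJet.cos
  have hs := HasJet.sin
  have hk := fun k => HasJet.const k
  have e1 := hl.exp.unique ((((hc.mul (hk r)).add (hs.mul (hk d))).mul hu).add
    ((hc.mul (hk d)).add (hs.mul (hk (-r)))))
    (h1.mono fun t ht => by beta_reduce; rw [ht]; ring)
  have e2 := (hl.exp.mul hu₁).unique (((hc.mul (hk p)).mul hu).add (hs.mul (hk (-p))))
    (h2.mono fun t ht => by beta_reduce; rw [ht]; ring)
  obtain ⟨a0, a1, a2⟩ := e1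
  obtain ⟨-, b1, b2⟩ := e2
  have hd : Real.exp l₀ = d := by linarith
  rw [hd] at a1 a2 b1 b2
  refine ⟨by linarith, by linarith, by linarith, by linarith⟩

/-- Modulo the coboundary of `e y + e² v²`, the second derivative of the logarithm of the expansion
is `(2 v - 1) (1 + e²)`. -/
lemma second_jet_eq_coboundary {p r d e e₁ v y v₁ y₁ l₁ l₂ : ℝ} (hp : p ≠ 0) (hd : d ≠ 0)
    (he : p * e₁ = r + d * e) (h1 : d * l₁ = r * (v - 1))
    (h2 : d * (l₁ * l₁ + l₂) = 2 * d * v + r * y - d) (h3 : d * v₁ = p * v - p)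
    (h4 : d * y₁ = p * y - 2 * (d * l₁) * v₁) :
    l₂ = (2 * v - 1) * (1 + e ^ 2) + ((e₁ * y₁ + e₁ ^ 2 * v₁ ^ 2) - (e * y + e ^ 2 * v ^ 2)) := by
  have hr : r = p * e₁ - d * e := by linarith
  have hv : v = (p + d * v₁) / p := by field_simp; linarith
  have hl₁ : l₁ = r * v₁ / p := by
    apply mul_left_cancel₀ hd
    rw [h1, hv]; field_simp; ring
  have hy : y = (d * y₁ + 2 * (d * l₁) * v₁) / p := by field_simp; linarith
  have hl₂ : l₂ = (2 * d * v + r * y - d) / d - l₁ * l₁ := by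
    rw [← h2]; field_simp; ring
  rw [hl₂, hy, hl₁, hv, hr]
  field_simp
  ring

/-! ### Cocycles with two graph-like invariant directions -/

section Graphs

variable {X : Type*} [TopologicalSpace X] {T : X ≃ₜ X}

lemma vec_ext {v w : Plane} (h0 : v 0 = w 0) (h1 : v 1 = w 1) : v = w := by
  ext i; fin_cases i
  · exact h0
  · exact h1

lemma continuous_vec {f g : X → ℝ} (hf : Continuous f) (hg : Continuous g) :
    Continuous fun x => (!₂[f x, g x] : Plane) := by
  refine (PiLp.continuous_toLp 2 _).comp (continuous_pi fun i => ?_)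
  fin_cases i
  · exact hf
  · exact hg

lemma isContinuousLineField_span {w : X → Plane} (hw : Continuous w) (hw0 : ∀ x, w x ≠ 0) :
    IsContinuousLineField fun x => Submodule.span ℝ {w x} :=
  fun _ => ⟨Set.univ, univ_mem, w, hw.continuousOn, fun x _ => ⟨hw0 x, rfl⟩⟩

lemma map_span_of_act {M : GL (Fin 2) ℝ} {v w : Plane} {κ : ℝ} (hκ : κ ≠ 0)
    (h : act M v = κ • w) :
    (Submodule.span ℝ {v}).map (act M).toLinearMap = Submodule.span ℝ {w} := by
  rw [Submodule.map_span, Set.image_singleton]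
  change Submodule.span ℝ {act M v} = _
  rw [h, Submodule.span_singleton_smul_eq (IsUnit.mk0 _ hκ)]

lemma one_le_norm_of_apply {v : Plane} {i : Fin 2} (h : v i = 1) : 1 ≤ ‖v‖ := by
  have := PiLp.norm_apply_le v i
  rwa [h, norm_one] at this

lemma norm_vec_le (a b : ℝ) : ‖(!₂[a, b] : Plane)‖ ≤ |a| + |b| := by
  have h := norm_sq_plane !₂[a, b]
  refine abs_le_of_sq_le_sq' ?_ (by positivity) |>.2
  rw [h]
  have h1 : (!₂[a, b] : Plane) 0 = a := rfl
  have h2 : (!₂[a, b] : Plane) 1 = b := rfl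
  rw [h1, h2, add_sq, sq_abs, sq_abs]
  have : 0 ≤ 2 * |a| * |b| := by positivity
  linarith

/-- A positive function on a compact space has bounded ratios. -/
lemma exists_ratio_bound [CompactSpace X] {φ : X → ℝ} (hφ : Continuous φ) (hφ0 : ∀ x, 0 < φ x) :
    ∃ C : ℝ, 0 < C ∧ ∀ x y, φ x ≤ C * φ y := by
  rcases isEmpty_or_nonempty X with hX | hX
  · exact ⟨1, one_pos, fun x => (hX.false x).elim⟩
  · obtain ⟨a, -, ha⟩ := isCompact_univ.exists_isMinOn Set.univ_nonempty hφ.continuousOn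
    obtain ⟨b, -, hb⟩ := isCompact_univ.exists_isMaxOn Set.univ_nonempty hφ.continuousOn
    refine ⟨φ b / φ a, div_pos (hφ0 b) (hφ0 a), fun x y => ?_⟩
    have h1 : φ x ≤ φ b := hb (Set.mem_univ x)
    have h2 : φ a ≤ φ y := ha (Set.mem_univ y)
    rw [div_mul_eq_mul_div, le_div_iff₀ (hφ0 a)]
    exact mul_le_mul h1 h2 (hφ0 a).le (hφ0 b).le

lemma decomposition {e u : ℝ} (h : 1 - e * u ≠ 0) (z : Plane) :
    z = ((z 0 - u * z 1) / (1 - e * u)) • (!₂[1, e] : Plane) +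
      ((z 1 - e * z 0) / (1 - e * u)) • (!₂[u, 1] : Plane) := by
  have h1 := div_mul_cancel₀ (z 0 - u * z 1) h
  have h2 := div_mul_cancel₀ (z 1 - e * z 0) h
  apply vec_ext
  · change z 0 = (z 0 - u * z 1) / (1 - e * u) * 1 + (z 1 - e * z 0) / (1 - e * u) * u
    apply mul_right_cancel₀ h
    linear_combination -h1 - u * h2
  · change z 1 = (z 0 - u * z 1) / (1 - e * u) * e + (z 1 - e * z 0) / (1 - e * u) * 1
    apply mul_right_cancel₀ h
    linear_combination -e * h1 - h2

/-- The spans of `(1, e)` and `(u, 1)` are invariant under `M`, with positive multipliers `α` and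
`m`, and `α / m` contracts in the weight `φ`. -/
structure IsGraphSplitting (T : X ≃ₜ X) (M : X → GL (Fin 2) ℝ) (e u α m φ : X → ℝ) (ρ K : ℝ) :
    Prop where
  continuous_e : Continuous e
  continuous_u : Continuous u
  act_e : ∀ x, act (M x) !₂[1, e x] = α x • !₂[1, e (T x)]
  act_u : ∀ x, act (M x) !₂[u x, 1] = m x • !₂[u (T x), 1]
  pos_α : ∀ x, 0 < α x
  pos_m : ∀ x, 0 < m x
  continuous_φ : Continuous φ
  pos_φ : ∀ x, 0 < φ x
  pos_ρ : 0 < ρ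
  ρ_lt_one : ρ < 1
  contracts : ∀ x, α x * φ (T x) ≤ ρ * φ x * m x
  abs_u_le : ∀ x, |u x| ≤ 1
  abs_e_le : ∀ x, |e x| ≤ K
  half_le : ∀ x, 1 / 2 ≤ 1 - e x * u x

namespace IsGraphSplitting

variable {M : X → GL (Fin 2) ℝ} {e u α m φ : X → ℝ} {ρ K : ℝ}

lemma exists_prod_le [CompactSpace X] (h : IsGraphSplitting T M e u α m φ ρ K) :
    ∃ C : ℝ, 0 < C ∧ ∀ n x, ∏ i ∈ Finset.range n, (α (T^[i] x) / m (T^[i] x)) ≤ C * ρ ^ n := by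
  obtain ⟨C, hC0, hC⟩ := exists_ratio_bound h.continuous_φ h.pos_φ
  refine ⟨C, hC0, fun n x => ?_⟩
  have h1 := prod_iterate_mul_le (T := T) (q := fun x => α x / m x) (φ := φ) h.pos_ρ.le
    (fun x => (div_pos (h.pos_α x) (h.pos_m x)).le) (fun x => by
      rw [div_mul_eq_mul_div, div_le_iff₀ (h.pos_m x)]; exact h.contracts x) n x
  have hφ := h.pos_φ (T^[n] x)
  have h2 := mul_le_mul_of_nonneg_left (hC x (T^[n] x)) (pow_nonneg h.pos_ρ.le n)
  refine le_of_mul_le_mul_right (h1.trans (h2.trans_eq ?_)) hφ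
  ring

lemma norm_e_le (h : IsGraphSplitting T M e u α m φ ρ K) (x : X) :
    ‖(!₂[1, e x] : Plane)‖ ≤ 1 + K := by
  have := norm_vec_le 1 (e x)
  rw [abs_one] at this
  linarith [h.abs_e_le x]

lemma norm_u_le (h : IsGraphSplitting T M e u α m φ ρ K) (x : X) :
    ‖(!₂[u x, 1] : Plane)‖ ≤ 2 := by
  have := norm_vec_le (u x) 1
  rw [abs_one] at this
  linarith [h.abs_u_le x]

lemma one_le_norm_e (e : ℝ) : 1 ≤ ‖(!₂[1, e] : Plane)‖ := one_le_norm_of_apply (i := 0) rfl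

lemma one_le_norm_u (u : ℝ) : 1 ≤ ‖(!₂[u, 1] : Plane)‖ := one_le_norm_of_apply (i := 1) rfl

lemma isDominatedSplitting [CompactSpace X] (h : IsGraphSplitting T M e u α m φ ρ K) :
    IsDominatedSplitting T M (fun x => Submodule.span ℝ {!₂[1, e x]})
      (fun x => Submodule.span ℝ {!₂[u x, 1]}) := by
  have he0 : ∀ x, (!₂[1, e x] : Plane) ≠ 0 := fun x =>
    norm_pos_iff.1 (one_pos.trans_le (one_le_norm_e _))
  have hu0 : ∀ x, (!₂[u x, 1] : Plane) ≠ 0 := fun x =>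
    norm_pos_iff.1 (one_pos.trans_le (one_le_norm_u _))
  have hne : ∀ x, 1 - e x * u x ≠ 0 := fun x => by linarith [h.half_le x]
  refine ⟨isContinuousLineField_span (continuous_vec continuous_const h.continuous_e) he0,
    isContinuousLineField_span (continuous_vec h.continuous_u continuous_const) hu0,
    fun x => ⟨?_, ?_⟩, fun x => finrank_span_singleton (he0 x),
    fun x => finrank_span_singleton (hu0 x), fun x => map_span_of_act (h.pos_α x).ne' (h.act_e x),
    fun x => map_span_of_act (h.pos_m x).ne' (h.act_u x), fun x => ?_⟩
  · rw [Submodule.disjoint_def]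
    intro z hz1 hz2
    obtain ⟨s, rfl⟩ := Submodule.mem_span_singleton.1 hz1
    obtain ⟨t, ht⟩ := Submodule.mem_span_singleton.1 hz2
    have h0 : t * u x = s * 1 := congrArg (fun v : Plane => v 0) ht
    have h1 : t * 1 = s * e x := congrArg (fun v : Plane => v 1) ht
    have hs : s * (1 - e x * u x) = 0 := by linear_combination -h0 + u x * h1
    rw [(mul_eq_zero.1 hs).resolve_right (hne x), zero_smul]
  · rw [codisjoint_iff, Submodule.eq_top_iff']
    intro z
    rw [decomposition (hne x) z]
    exact Submodule.add_mem_sup (Submodule.smul_mem _ _ (Submodule.mem_span_singleton_self _))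
      (Submodule.smul_mem _ _ (Submodule.mem_span_singleton_self _))
  · obtain ⟨C, hC0, hC⟩ := h.exists_prod_le
    have hK : 0 ≤ K := (abs_nonneg _).trans (h.abs_e_le x)
    have hlim : Tendsto (fun n : ℕ => C * ρ ^ n * ((1 + K) * 2)) atTop (𝓝 (C * 0 * ((1 + K) * 2))) :=
      ((tendsto_pow_atTop_nhds_zero_of_lt_one h.pos_ρ.le h.ρ_lt_one).const_mul C).mul_const _
    rw [mul_zero, zero_mul] at hlim
    obtain ⟨l, hl1, hl2⟩ := ((hlim.eventually (gt_mem_nhds (show (0 : ℝ) < 1 / 2 by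
      norm_num))).and (eventually_ge_atTop 1)).exists
    refine ⟨l, hl2, ?_⟩
    rw [restrictNorm_fwd_mul_restrictNorm_bwd h.act_e h.act_u he0 hu0]
    refine lt_of_le_of_lt ?_ hl1
    have habs : ∏ i ∈ Finset.range l, |α (T^[i] x)| / |m (T^[i] x)| =
        ∏ i ∈ Finset.range l, (α (T^[i] x) / m (T^[i] x)) :=
      Finset.prod_congr rfl fun i _ => by rw [abs_of_pos (h.pos_α _), abs_of_pos (h.pos_m _)]
    rw [habs]
    refine mul_le_mul (hC l x) (mul_le_mul ?_ ?_ (by positivity) (by positivity)) (by positivity)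
      (mul_nonneg hC0.le (pow_nonneg h.pos_ρ.le _))
    · exact (div_le_self (norm_nonneg _) (one_le_norm_e _)).trans (h.norm_e_le _)
    · exact (div_le_self (norm_nonneg _) (one_le_norm_u _)).trans (h.norm_u_le _)

lemma exists_abs_log_norm_sub_le [CompactSpace X] (h : IsGraphSplitting T M e u α m φ ρ K) :
    ∃ B : ℝ, ∀ n x, |Real.log ‖act (fwd T M n x)‖ -
      birkhoffSum T (fun y => Real.log (m y)) n x| ≤ B := by
  rcases isEmpty_or_nonempty X with hX | ⟨⟨x₀⟩⟩
  · exact ⟨0, fun n x => (hX.false x).elim⟩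
  have hK : 0 ≤ K := (abs_nonneg _).trans (h.abs_e_le x₀)
  obtain ⟨C, hC0, hC⟩ := h.exists_prod_le
  refine exists_abs_log_norm_fwd_sub_le (K := 4 + 2 * K) (C := C) h.act_e h.act_u
    (fun x => by linarith [h.norm_e_le x]) (fun x => by linarith [h.norm_u_le x])
    (fun x => one_le_norm_u _) (fun x z => ?_) h.pos_α h.pos_m (fun n x => ?_)
  · have hpos : 0 < 1 - e x * u x := by linarith [h.half_le x]
    have hz0 : |z 0| ≤ ‖z‖ := PiLp.norm_apply_le z 0
    have hz1 : |z 1| ≤ ‖z‖ := PiLp.norm_apply_le z 1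
    have key : ∀ a b k : ℝ, |a| ≤ ‖z‖ → |b| ≤ ‖z‖ → |k| ≤ 1 + K →
        |(a - k * b) / (1 - e x * u x)| ≤ (4 + 2 * K) * ‖z‖ := by
      intro a b k ha hb hk
      have h1 : |a - k * b| ≤ ‖z‖ + (1 + K) * ‖z‖ := by
        refine (abs_sub _ _).trans (add_le_add ha ?_)
        rw [abs_mul]
        exact mul_le_mul hk hb (abs_nonneg _) (by linarith)
      rw [abs_div, abs_of_pos hpos, div_le_iff₀ hpos]
      have h2 : (4 + 2 * K) * ‖z‖ * (1 / 2) ≤ (4 + 2 * K) * ‖z‖ * (1 - e x * u x) :=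
        mul_le_mul_of_nonneg_left (h.half_le x) (by positivity)
      linarith
    exact ⟨_, _, decomposition hpos.ne' z,
      key _ _ _ hz0 hz1 (by linarith [h.abs_u_le x]), key _ _ _ hz1 hz0 (by linarith [h.abs_e_le x])⟩
  · have h1 := hC n x
    rw [Finset.prod_div_distrib, div_le_iff₀ (Finset.prod_pos fun i _ => h.pos_m _)] at h1
    refine h1.trans (mul_le_mul_of_nonneg_right ?_ (Finset.prod_nonneg fun i _ => (h.pos_m _).le))
    exact mul_le_of_le_one_right hC0.le (pow_le_one₀ h.pos_ρ.le h.ρ_lt_one.le)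

end IsGraphSplitting

end Graphs


/-! ### The rotated family of a lower triangular cocycle -/

section Families

variable {X : Type*} [TopologicalSpace X] [CompactSpace X] {T : X ≃ₜ X} {p d φ : C(X, ℝ)} {ρ : ℝ}

/-- The invariant directions `(u, 1)` and `(1, e)` of the matrices with rows
`(p cos θ, -p sin θ)` and `(r cos θ + d sin θ, d cos θ - r sin θ)`, and the logarithm `l` of the
expansion along `(u, 1)`. All the inequalities are strict at `θ = 0`, uniformly in the point, hence
persist. -/
theorem exists_families (r : C(X, ℝ)) (hp : ∀ x, 0 < p x) (hd : ∀ x, 0 < d x) (hφ : ∀ x, 0 < φ x)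
    (hρ : 0 < ρ) (hρ1 : ρ < 1) (h : ∀ x, p x * φ (T x) ≤ ρ * φ x * d x) :
    ∃ (u e l : ℝ → C(X, ℝ)) (ρ' K : ℝ), AnalyticAt ℝ u 0 ∧ AnalyticAt ℝ l 0 ∧ u 0 = 0 ∧
      0 < ρ' ∧ ρ' < 1 ∧ ∀ᶠ θ in 𝓝 (0 : ℝ),
        (∀ x, Real.exp (l θ x) = (Real.cos θ * r x + Real.sin θ * d x) * u θ x +
          (Real.cos θ * d x - Real.sin θ * r x)) ∧
        (∀ x, Real.exp (l θ x) * u θ (T x) = Real.cos θ * p x * u θ x - Real.sin θ * p x) ∧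
        (∀ x, (Real.cos θ * p x - Real.sin θ * p x * e θ x) * e θ (T x) =
          (Real.cos θ * r x + Real.sin θ * d x) +
            (Real.cos θ * d x - Real.sin θ * r x) * e θ x) ∧
        (∀ x, 0 < Real.cos θ * p x - Real.sin θ * p x * e θ x) ∧
        (∀ x, (Real.cos θ * p x - Real.sin θ * p x * e θ x) * φ (T x) ≤
          ρ' * φ x * Real.exp (l θ x)) ∧
        (∀ x, |u θ x| ≤ 1) ∧ (∀ x, |e θ x| ≤ K) ∧ ∀ x, 1 / 2 ≤ 1 - e θ x * u θ x := by
  obtain ⟨u, hu, hu0, hueq⟩ := exists_analyticAt_dominating_direction r hp hd hφ hρ.le hρ1 h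
  obtain ⟨e, he, heeq⟩ := exists_analyticAt_dominated_direction r hp hd hφ hρ.le hρ1 h
  have hcos : AnalyticAt ℝ Real.cos 0 := Real.analyticAt_cos
  have hsin : AnalyticAt ℝ Real.sin 0 := Real.analyticAt_sin
  set m : ℝ → C(X, ℝ) := fun θ =>
    (Real.cos θ • r + Real.sin θ • d) * u θ + (Real.cos θ • d - Real.sin θ • r) with hm
  have hman : AnalyticAt ℝ m 0 :=
    (((hcos.smul analyticAt_const).add (hsin.smul analyticAt_const)).mul hu).add
      ((hcos.smul analyticAt_const).sub (hsin.smul analyticAt_const))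
  have hm0 : m 0 = d := by simp [hm, hu0]
  obtain ⟨l, hl, hlexp⟩ := exists_analyticAt_log hman (by rw [hm0]; exact hd)
  set α : ℝ → C(X, ℝ) := fun θ => Real.cos θ • p - Real.sin θ • p * e θ with hα
  have hαc : ContinuousAt α 0 :=
    ((hcos.smul analyticAt_const).sub ((hsin.smul analyticAt_const).mul he)).continuousAt
  have hα0 : α 0 = p := by simp [hα]
  have hαpos := eventually_forall_pos hαc (by rw [hα0]; exact hp)
  have hcontr := eventually_forall_pos (F := fun θ => ((1 + ρ) / 2) • φ * m θ - α θ * koopman T φ)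
    ((continuousAt_const.mul hman.continuousAt).sub (hαc.mul continuousAt_const)) (fun x => by
      rw [hm0, hα0]
      have h1 := mul_pos (mul_pos (show 0 < (1 - ρ) / 2 by linarith) (hφ x)) (hd x)
      have h2 := h x
      change 0 < ((1 + ρ) / 2) * φ x * d x - p x * φ (T x)
      linarith)
  have hhalf := eventually_forall_pos (F := fun θ => (1 / 2 : ℝ) • (1 : C(X, ℝ)) - e θ * u θ)
    (continuousAt_const.sub (he.continuousAt.mul hu.continuousAt)) (fun x => by
      rw [hu0]; simp)
  have hu1 : ∀ᶠ θ in 𝓝 (0 : ℝ), ‖u θ‖ < 1 :=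
    hu.continuousAt.norm.eventually_lt continuousAt_const (by simp [hu0])
  have he1 : ∀ᶠ θ in 𝓝 (0 : ℝ), ‖e θ‖ < ‖e 0‖ + 1 :=
    he.continuousAt.norm.eventually_lt continuousAt_const (by linarith)
  refine ⟨u, e, l, (1 + ρ) / 2, ‖e 0‖ + 1, hu, hl, hu0, by linarith, by linarith, ?_⟩
  filter_upwards [hueq, heeq, hlexp, hαpos, hcontr, hhalf, hu1, he1]
    with θ h1 h2 h3 h4 h5 h6 h7 h8
  refine ⟨fun x => h3 x, fun x => ?_, fun x => DFunLike.congr_fun h2 x, fun x => h4 x, fun x => ?_,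
    fun x => ((u θ).norm_coe_le_norm x).trans h7.le,
    fun x => ((e θ).norm_coe_le_norm x).trans h8.le, fun x => ?_⟩
  · rw [h3 x]
    exact DFunLike.congr_fun h1 x
  · rw [h3 x]
    have h9 : 0 < ((1 + ρ) / 2) * φ x * m θ x - α θ x * φ (T x) := h5 x
    change α θ x * φ (T x) ≤ _
    linarith
  · have h9 : 0 < (1 / 2 : ℝ) * 1 - e θ x * u θ x := h6 x
    linarith

/-- A maximum principle, in the weight `φ`. -/
lemma nonpos_of_transfer {v : C(X, ℝ)} (hp : ∀ x, 0 < p x) (hd : ∀ x, 0 < d x) (hφ : ∀ x, 0 < φ x)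
    (hρ : 0 < ρ) (hρ1 : ρ < 1) (h : ∀ x, p x * φ (T x) ≤ ρ * φ x * d x)
    (hv : ∀ x, d x * v (T x) = p x * v x - p x) (x : X) : v x ≤ 0 := by
  obtain ⟨z, -, hz⟩ := isCompact_univ.exists_isMaxOn ⟨x, Set.mem_univ x⟩
    (v * φ).continuous.continuousOn
  have hz' : ∀ y, v y * φ y ≤ v z * φ z := fun y => hz (Set.mem_univ y)
  suffices hvz : v z ≤ 0 by
    have h1 : v x * φ x ≤ 0 := (hz' x).trans (mul_nonpos_of_nonpos_of_nonneg hvz (hφ z).le)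
    exact nonpos_of_mul_nonpos_left h1 (hφ x)
  by_contra! hpos
  set y := T.symm z with hy
  have hTy : T y = z := T.apply_symm_apply z
  have e1 := hv y
  have e2 := h y
  rw [hTy] at e1 e2
  have hvy : 0 < v y - 1 := by
    have : 0 < p y * (v y - 1) := by
      have := mul_pos (hd y) hpos
      linarith
    exact pos_of_mul_pos_right this (hp y).le
  -- with `p`, `d` taken at `y`:
  -- `d (v φ)(z) = p φ(z) (v(y) - 1) ≤ ρ d φ(y) (v(y) - 1) < d (v φ)(y)`, against maximality at `z`
  have h1 : d y * (v z * φ z) ≤ ρ * φ y * d y * (v y - 1) := by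
    calc d y * (v z * φ z) = p y * φ z * (v y - 1) := by linear_combination φ z * e1
      _ ≤ _ := mul_le_mul_of_nonneg_right e2 hvy.le
  have h2 : ρ * φ y * d y * (v y - 1) < d y * (v y * φ y) := by
    have hk := mul_pos (hφ y) (hd y)
    have h3 : ρ * (v y - 1) < v y := by nlinarith
    have := mul_lt_mul_of_pos_left h3 hk
    linarith
  have h3 := mul_le_mul_of_nonneg_left (hz' y) (hd y).le
  linarith

end Families

section Integral

variable {X : Type*} [TopologicalSpace X] [CompactSpace X] [MeasurableSpace X]
  [BorelSpace X] (μ : Measure X) [IsProbabilityMeasure μ]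

lemma integrable_continuousMap (f : C(X, ℝ)) : Integrable f μ :=
  Integrable.of_bound f.continuous.measurable.aestronglyMeasurable ‖f‖
    (ae_of_all _ fun x => f.norm_coe_le_norm x)

/-- Integration against a probability measure, as a functional on continuous functions. -/
noncomputable def integralFunctional : C(X, ℝ) →L[ℝ] ℝ :=
  LinearMap.mkContinuous
    { toFun := fun f => ∫ x, f x ∂μ
      map_add' := fun f g => integral_add (integrable_continuousMap μ f)
        (integrable_continuousMap μ g)
      map_smul' := fun c f => integral_const_mul c f } 1 fun f => by
    refine (norm_integral_le_of_norm_le_const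
      (ae_of_all _ fun x => f.norm_coe_le_norm x)).trans_eq ?_
    rw [probReal_univ, mul_one, one_mul]

lemma integralFunctional_apply (f : C(X, ℝ)) : integralFunctional μ f = ∫ x, f x ∂μ := rfl

variable {μ} {T : X ≃ₜ X} {p r d φ : C(X, ℝ)} {ρ : ℝ}

/-- Modulo a coboundary, the second derivative of `l` at the origin is `(2 v - 1) (1 + e²)`, where
`v ≤ 0` is the derivative of `u`; so its integral is at most `-1`. -/
theorem integral_deriv_deriv_neg (hT : MeasurePreserving T μ μ) (hp : ∀ x, 0 < p x)
    (hd : ∀ x, 0 < d x) (hφ : ∀ x, 0 < φ x) (hρ : 0 < ρ) (hρ1 : ρ < 1)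
    (h : ∀ x, p x * φ (T x) ≤ ρ * φ x * d x) {u l : ℝ → C(X, ℝ)} {e : C(X, ℝ)}
    (hu : AnalyticAt ℝ u 0) (hl : AnalyticAt ℝ l 0) (hu0 : u 0 = 0)
    (he : ∀ x, p x * e (T x) = r x + d x * e x)
    (h1 : ∀ᶠ θ in 𝓝 (0 : ℝ), ∀ x, Real.exp (l θ x) =
      (Real.cos θ * r x + Real.sin θ * d x) * u θ x + (Real.cos θ * d x - Real.sin θ * r x))
    (h2 : ∀ᶠ θ in 𝓝 (0 : ℝ), ∀ x, Real.exp (l θ x) * u θ (T x) =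
      Real.cos θ * p x * u θ x - Real.sin θ * p x) :
    ∫ x, deriv (deriv l) 0 x ∂μ < 0 := by
  have hjet : ∀ {F : ℝ → C(X, ℝ)}, AnalyticAt ℝ F 0 → ∀ x,
      HasJet (fun θ => F θ x) (F 0 x) (deriv F 0 x) (deriv (deriv F) 0 x) := fun hF x =>
    HasJet.of_clm hF (ContinuousMap.evalCLM ℝ x)
  have hjetu : ∀ x, HasJet (fun θ => u θ x) 0 (deriv u 0 x) (deriv (deriv u) 0 x) := fun x => by
    have := hjet hu x
    rwa [hu0] at this
  have hrel := fun x => jet_relations (hjetu x) (hjetu (T x)) (hjet hl x)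
    (h1.mono fun θ hθ => hθ x) (h2.mono fun θ hθ => hθ x)
  set v := deriv u 0
  set y := deriv (deriv u) 0
  have hv : ∀ x, v x ≤ 0 := nonpos_of_transfer hp hd hφ hρ hρ1 h fun x => (hrel x).2.2.1
  set G : C(X, ℝ) := e * y + e * e * v * v with hG
  set S : C(X, ℝ) := (v + v - 1) * (1 + e * e) with hS
  have hsecond : ∀ x, deriv (deriv l) 0 x = S x + (G (T x) - G x) := by
    intro x
    obtain ⟨a1, a2, a3, a4⟩ := hrel x
    rw [second_jet_eq_coboundary (hp x).ne' (hd x).ne' (he x) a1 a2 a3 a4]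
    simp only [hS, hG, ContinuousMap.mul_apply, ContinuousMap.add_apply, ContinuousMap.sub_apply,
      ContinuousMap.one_apply]
    ring
  have hGT : ∫ x, G (T x) ∂μ = ∫ x, G x ∂μ := by
    rw [← integral_map (f := G) hT.measurable.aemeasurable
      G.continuous.measurable.aestronglyMeasurable, hT.map_eq]
  have hGTi : Integrable (fun x => G (T x)) μ := integrable_continuousMap μ (koopman T G)
  have hdiff : Integrable (fun x => G (T x) - G x) μ := hGTi.sub (integrable_continuousMap μ G)
  simp_rw [hsecond]
  rw [integral_add (integrable_continuousMap μ S) hdiff,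
    integral_sub hGTi (integrable_continuousMap μ G), hGT, sub_self, add_zero]
  have hS1 : ∫ x, S x ∂μ ≤ ∫ _, (-1 : ℝ) ∂μ := by
    refine integral_mono (integrable_continuousMap μ S) (integrable_const _) fun x => ?_
    have := hv x
    change (v x + v x - 1) * (1 + e x * e x) ≤ -1
    nlinarith [mul_self_nonneg (e x)]
  rw [integral_const, probReal_univ, one_smul] at hS1
  linarith

end Integral

section Triangular

variable {X : Type*}

lemma rotation_zero : rotation 0 = 1 := by
  ext i j; fin_cases i <;> fin_cases j <;> simp [rotation]

lemma rotated_zero (A : X → GL (Fin 2) ℝ) : rotated A 0 = A := by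
  funext x; rw [rotated, rotation_zero, mul_one]

lemma rotated_zero_zero {H : X → GL (Fin 2) ℝ} {x : X} (h : H x 0 1 = 0) (θ : ℝ) :
    rotated H θ x 0 0 = Real.cos θ * H x 0 0 := by
  simp [rotated, rotation, Matrix.mul_apply, Fin.sum_univ_two, h, mul_comm]

lemma rotated_zero_one {H : X → GL (Fin 2) ℝ} {x : X} (h : H x 0 1 = 0) (θ : ℝ) :
    rotated H θ x 0 1 = -(Real.sin θ * H x 0 0) := by
  simp [rotated, rotation, Matrix.mul_apply, Fin.sum_univ_two, h, mul_comm]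

lemma rotated_one_zero (H : X → GL (Fin 2) ℝ) (θ : ℝ) (x : X) :
    rotated H θ x 1 0 = Real.cos θ * H x 1 0 + Real.sin θ * H x 1 1 := by
  simp [rotated, rotation, Matrix.mul_apply, Fin.sum_univ_two, mul_comm]

lemma rotated_one_one (H : X → GL (Fin 2) ℝ) (θ : ℝ) (x : X) :
    rotated H θ x 1 1 = Real.cos θ * H x 1 1 - Real.sin θ * H x 1 0 := by
  simp [rotated, rotation, Matrix.mul_apply, Fin.sum_univ_two, mul_comm]
  ring

end Triangular

end RotatedCocycle

/-! ### The exponent of the rotated family -/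

open RotatedCocycle

theorem mainTheorem2 {X : Type*} [MetricSpace X] [CompactSpace X] [MeasurableSpace X]
    [BorelSpace X] (T : X ≃ₜ X) (μ : Measure X) [IsProbabilityMeasure μ] (hμ : Ergodic T μ)
    (A : X → GL (Fin 2) ℝ) (hA : Continuous A)
    (hdet : ∀ x, 0 < (A x : Matrix (Fin 2) (Fin 2) ℝ).det)
    (hdom : RotatedCocycle.HasDominatedSplitting T A) :
    ∃ ε : ℝ, 0 < ε ∧
      -- the exponents that occur exist
      RotatedCocycle.IsUpperExponent T μ A (RotatedCocycle.upperExponent T μ A) ∧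
      RotatedCocycle.IsLowerExponent T μ A (RotatedCocycle.lowerExponent T μ A) ∧
      (∀ θ ∈ Set.Ioo (-ε) ε,
        RotatedCocycle.IsUpperExponent T μ (RotatedCocycle.rotated A θ)
          (RotatedCocycle.upperExponent T μ (RotatedCocycle.rotated A θ))) ∧
      -- the formula, with real analytic `a`, `c`, `u`
      (∃ a c u : ℝ → X → ℝ,
        (∀ θ ∈ Set.Ioo (-ε) ε, Continuous (a θ) ∧ Continuous (c θ) ∧ Continuous (u θ)) ∧
        (∀ θ ∈ Set.Ioo (-ε) ε, ∀ x, 0 < a θ x - c θ x * u θ (T x)) ∧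
        (∀ θ ∈ Set.Ioo (-ε) ε,
          RotatedCocycle.upperExponent T μ (RotatedCocycle.rotated A θ) =
            RotatedCocycle.upperExponent T μ A + RotatedCocycle.lowerExponent T μ A -
              ∫ x, Real.log (a θ x - c θ x * u θ (T x)) ∂μ) ∧
        (∀ x, AnalyticOnNhd ℝ (fun θ => a θ x) (Set.Ioo (-ε) ε) ∧
          AnalyticOnNhd ℝ (fun θ => c θ x) (Set.Ioo (-ε) ε) ∧
          AnalyticOnNhd ℝ (fun θ => u θ x) (Set.Ioo (-ε) ε)) ∧
        -- what `a`, `c`, `u` are: `(a, c)` is the first column of a lower triangular cocycle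
        -- quasi-conjugated to `A`, rotated by `θ`, and `(u, 1)` spans its dominating direction
        (∃ H : X → GL (Fin 2) ℝ, Continuous H ∧ RotatedCocycle.QuasiConjugated T A H ∧
          (∀ x, (H x : Matrix (Fin 2) (Fin 2) ℝ) 0 1 = 0) ∧
          (∀ θ ∈ Set.Ioo (-ε) ε, ∀ x,
            a θ x = (RotatedCocycle.rotated H θ x : Matrix (Fin 2) (Fin 2) ℝ) 0 0 ∧
            c θ x = (RotatedCocycle.rotated H θ x : Matrix (Fin 2) (Fin 2) ℝ) 1 0) ∧
          (∀ x, u 0 x = 0) ∧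
          ContinuousOn (fun p : ℝ × X => u p.1 p.2) (Set.Ioo (-ε) ε ×ˢ Set.univ) ∧
          (∀ θ ∈ Set.Ioo (-ε) ε, ∃ E : X → Submodule ℝ RotatedCocycle.Plane,
            RotatedCocycle.IsDominatedSplitting T (RotatedCocycle.rotated H θ) E
              (fun x => Submodule.span ℝ {(!₂[u θ x, 1] : RotatedCocycle.Plane)})))) ∧
      -- analyticity of the exponent and negativity of its second derivative at `0`
      AnalyticOnNhd ℝ
        (fun θ => RotatedCocycle.upperExponent T μ (RotatedCocycle.rotated A θ))
        (Set.Ioo (-ε) ε) ∧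
      iteratedDeriv 2
        (fun θ => RotatedCocycle.upperExponent T μ (RotatedCocycle.rotated A θ)) 0 < 0 := by
  obtain ⟨H, φ₀, ρ, hHc, hqc, h01, hp, hd, hφc, hφ, hρ, hρ1, hφH⟩ :=
    exists_lowerTriangular hA hdet hdom
  have hHv : Continuous fun x => (H x : Matrix (Fin 2) (Fin 2) ℝ) := Units.continuous_val.comp hHc
  set p : C(X, ℝ) := ⟨fun x => H x 0 0, hHv.matrix_elem 0 0⟩
  set r : C(X, ℝ) := ⟨fun x => H x 1 0, hHv.matrix_elem 1 0⟩
  set d : C(X, ℝ) := ⟨fun x => H x 1 1, hHv.matrix_elem 1 1⟩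
  set φ : C(X, ℝ) := ⟨φ₀, hφc⟩
  replace hp : ∀ x, 0 < p x := hp
  replace hd : ∀ x, 0 < d x := hd
  replace hφ : ∀ x, 0 < φ x := hφ
  replace hφH : ∀ x, p x * φ (T x) ≤ ρ * φ x * d x := hφH
  obtain ⟨u, e, l, ρ', K, hu, hl, hu0, hρ', hρ'1, hev⟩ :=
    exists_families (T := T) (p := p) (d := d) (φ := φ) r hp hd hφ hρ hρ1 hφH
  have hev0 := hev.self_of_nhds
  obtain ⟨ε, hε, hball⟩ := Metric.eventually_nhds_iff_ball.1
    (hev.and (hu.eventually_analyticAt.and hl.eventually_analyticAt))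
  rw [Real.ball_eq_Ioo, zero_sub, zero_add] at hball
  have hε0 : (0 : ℝ) ∈ Set.Ioo (-ε) ε := ⟨by linarith, hε⟩
  -- the splitting of the rotated lower triangular cocycle
  have hsplit : ∀ θ ∈ Set.Ioo (-ε) ε, IsGraphSplitting T (rotated H θ) (e θ) (u θ)
      (fun x => Real.cos θ * p x - Real.sin θ * p x * e θ x) (fun x => Real.exp (l θ x)) φ ρ' K := by
    intro θ hθ
    obtain ⟨⟨h1, h2, h3, h4, h5, h6, h7, h8⟩, -⟩ := hball θ hθ
    refine ⟨(e θ).continuous, (u θ).continuous, fun x => ?_, fun x => ?_, h4,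
      fun x => Real.exp_pos _, hφc, hφ, hρ', hρ'1, h5, h6, h7, h8⟩
    · apply vec_ext
      · rw [act_apply_zero, rotated_zero_zero (h01 x), rotated_zero_one (h01 x)]
        change Real.cos θ * p x * 1 + -(Real.sin θ * p x) * e θ x = _ * 1
        ring
      · rw [act_apply_one, rotated_one_zero, rotated_one_one]
        change (Real.cos θ * r x + Real.sin θ * d x) * 1 +
          (Real.cos θ * d x - Real.sin θ * r x) * e θ x = _ * e θ (T x)
        rw [h3 x]; ring
    · apply vec_ext
      · rw [act_apply_zero, rotated_zero_zero (h01 x), rotated_zero_one (h01 x)]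
        change Real.cos θ * p x * u θ x + -(Real.sin θ * p x) * 1 = _ * u θ (T x)
        rw [h2 x]; ring
      · rw [act_apply_one, rotated_one_zero, rotated_one_one]
        change (Real.cos θ * r x + Real.sin θ * d x) * u θ x +
          (Real.cos θ * d x - Real.sin θ * r x) * 1 = _ * 1
        rw [h1 x]; ring
  have hnorm : ∀ θ ∈ Set.Ioo (-ε) ε, ∃ B : ℝ, ∀ n x,
      |Real.log ‖act (fwd T (rotated A θ) n x)‖ - birkhoffSum T (l θ) n x| ≤ B := by
    intro θ hθ
    obtain ⟨B, hB⟩ := (hsplit θ hθ).exists_abs_log_norm_sub_le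
    refine ⟨B, fun n x => ?_⟩
    have := hB n x
    simp only [Real.log_exp] at this
    rwa [← (hqc.rotated θ).norm_act_fwd] at this
  have hupper : ∀ θ ∈ Set.Ioo (-ε) ε,
      IsUpperExponent T μ (rotated A θ) (∫ x, l θ x ∂μ) := by
    intro θ hθ
    obtain ⟨B, hB⟩ := hnorm θ hθ
    exact isUpperExponent_of_abs_sub_le hμ (l θ).continuous (fun x => (l θ).norm_coe_le_norm x) hB
  have hupper_eq : ∀ θ ∈ Set.Ioo (-ε) ε,
      upperExponent T μ (rotated A θ) = ∫ x, l θ x ∂μ :=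
    fun θ hθ => upperExponent_eq (hupper θ hθ)
  have hupper0 : IsUpperExponent T μ A (∫ x, l 0 x ∂μ) := by
    have := hupper 0 hε0
    rwa [rotated_zero] at this
  have hexp0 : ∀ x, Real.exp (l 0 x) = d x := fun x => by
    have := hev0.1 x
    rw [this, hu0]
    simp
  have hdetA : ∀ x, (A x : Matrix (Fin 2) (Fin 2) ℝ).det = d x * p x := fun x => by
    rw [← hqc.det_eq, Matrix.det_fin_two, h01]
    change p x * d x - 0 * r x = d x * p x
    ring
  set logp : C(X, ℝ) := ⟨fun x => Real.log (p x), p.continuous.log fun x => (hp x).ne'⟩ with hlogp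
  have hlower : IsLowerExponent T μ A (∫ x, logp x ∂μ) := by
    obtain ⟨B, hB⟩ := hnorm 0 hε0
    rw [rotated_zero] at hB
    refine isLowerExponent_of_abs_sub_le hμ logp.continuous
      (fun x => logp.norm_coe_le_norm x) hdet (fun x => ?_) hB
    rw [hdetA, Real.log_mul (hd x).ne' (hp x).ne', ← Real.log_exp (l 0 x), hexp0]
    rfl
  have hg : ∀ θ ∈ Set.Ioo (-ε) ε, ∀ x,
      Real.cos θ * p x - (Real.cos θ * r x + Real.sin θ * d x) * u θ (T x) =
        Real.exp (logp x + l 0 x - l θ x) := by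
    intro θ hθ x
    obtain ⟨⟨h1, h2, -⟩, -⟩ := hball θ hθ
    rw [Real.exp_sub, Real.exp_add, hexp0, hlogp]
    change _ = Real.exp (Real.log (p x)) * d x / _
    rw [Real.exp_log (hp x), eq_div_iff (Real.exp_pos _).ne']
    -- the determinant of the rotated matrix is the product of its two multipliers
    linear_combination (Real.cos θ * p x) * h1 x -
      (Real.cos θ * r x + Real.sin θ * d x) * h2 x + p x * d x * Real.sin_sq_add_cos_sq θ
  refine ⟨ε, hε, ?_, ?_, ?_, ?_, ?_, ?_⟩
  · rwa [upperExponent_eq hupper0]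
  · rwa [lowerExponent_eq hlower]
  · intro θ hθ
    rw [hupper_eq θ hθ]
    exact hupper θ hθ
  · refine ⟨fun θ x => Real.cos θ * p x, fun θ x => Real.cos θ * r x + Real.sin θ * d x,
      fun θ x => u θ x, fun θ _ => ⟨continuous_const.mul p.continuous,
        (continuous_const.mul r.continuous).add (continuous_const.mul d.continuous),
        (u θ).continuous⟩, fun θ hθ x => ?_, fun θ hθ => ?_, fun x => ⟨?_, ?_, ?_⟩, H, hHc, hqc,
      h01, fun θ _ x => ⟨(rotated_zero_zero (h01 x) θ).symm, (rotated_one_zero H θ x).symm⟩,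
      fun x => DFunLike.congr_fun hu0 x, ?_, fun θ hθ => ⟨_, (hsplit θ hθ).isDominatedSplitting⟩⟩
    · rw [hg θ hθ]; exact Real.exp_pos _
    · have hint : ∫ x, Real.log (Real.cos θ * p x -
          (Real.cos θ * r x + Real.sin θ * d x) * u θ (T x)) ∂μ =
          integralFunctional μ (logp + l 0 - l θ) := by
        rw [integralFunctional_apply]
        refine integral_congr_ae (ae_of_all _ fun x => ?_)
        beta_reduce
        rw [hg θ hθ, Real.log_exp]
        rfl
      rw [hupper_eq θ hθ, upperExponent_eq hupper0, lowerExponent_eq hlower, hint, map_sub, map_add]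
      simp only [integralFunctional_apply]
      ring
    · exact fun θ _ => Real.analyticAt_cos.mul analyticAt_const
    · exact fun θ _ => (Real.analyticAt_cos.mul analyticAt_const).add
        (Real.analyticAt_sin.mul analyticAt_const)
    · exact fun θ hθ => AnalyticAt.fun_comp ((ContinuousMap.evalCLM ℝ x).analyticAt _)
        (hball θ hθ).2.1
    · have huc : ContinuousOn u (Set.Ioo (-ε) ε) := fun θ hθ =>
        (hball θ hθ).2.1.continuousAt.continuousWithinAt
      have hpair : ContinuousOn (fun q : ℝ × X => (u q.1, q.2)) (Set.Ioo (-ε) ε ×ˢ Set.univ) :=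
        (huc.comp continuousOn_fst fun q hq => hq.1).prodMk continuousOn_snd
      exact continuous_eval.comp_continuousOn hpair
  · intro θ hθ
    have han : AnalyticAt ℝ (fun θ => integralFunctional μ (l θ)) θ :=
      AnalyticAt.fun_comp ((integralFunctional μ).analyticAt _) (hball θ hθ).2.2
    refine han.congr ?_
    filter_upwards [isOpen_Ioo.mem_nhds hθ] with t ht
    exact (hupper_eq t ht).symm
  · have heq : (fun θ => upperExponent T μ (rotated A θ)) =ᶠ[𝓝 0]
        fun θ => integralFunctional μ (l θ) := by
      filter_upwards [isOpen_Ioo.mem_nhds hε0] with t ht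
      exact hupper_eq t ht
    rw [iteratedDeriv_succ, iteratedDeriv_one, heq.deriv.deriv_eq,
      (HasJet.of_clm hl (integralFunctional μ)).deriv_deriv_eq, integralFunctional_apply]
    refine integral_deriv_deriv_neg (r := r) (e := e 0) hμ.toMeasurePreserving hp hd hφ hρ hρ1 hφH hu
      hl hu0 (fun x => ?_) (hev.mono fun θ h => h.1) (hev.mono fun θ h => h.2.1)
    simpa using hev0.2.2.1 x
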